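/- \textbf{Setting.} Fix a finite set $Q$ and dimensions $N_q\ge 1$ ($q\in Q$), and place, in every unit cell $c\in\mathbb Z^2$ of the infinite plane, one qudit of dimension $N_q$ for each $q\in Q$. Let $\mathcal P$ be the Pauli group: all products of finitely many single-site operators $X=\sum_{\alpha}|\alpha+1\rangle\langle\alpha|$, $Z=\sum_\alpha e^{2\pi i\alpha/N}|\alpha\rangle\langle\alpha|$ and phases in $U(1)$. The support of a Pauli operator is the set of cells on which it acts by more than a phase. Linear sizes and distances are measured on $\mathbb Z^2$ in the sup-norm. A \emph{translation-invariant topological subsystem code} consists of a gauge group $\mathcal G\le\mathcal P$ containing all phases and a stabilizer group $\mathcal S\le\mathcal P$ containing no multiple of the identity other than $1$, such that: the center of $\mathcal G$ equals $U(1)\cdot\mathcal S$; $\mathcal G$ is invariant under translations by $\mathbb Z^2$; $\mathcal G$ is generated by gauge operators of linear size at most some constant $\ell_G$; $\mathcal S$ is generated by stabilizers of linear size at most some constant $\ell_S$; and the centralizer of $\mathcal S$ in $\mathcal P$ is $\mathcal G$. It is a \emph{topological stabilizer code} if $\mathcal G=U(1)\cdot\mathcal S$. A homomorphism $\Gamma:\mathcal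 G\to U(1)$ \emph{violates} $G\in\mathcal G$ if $\Gamma(G)\ne 1$, and is \emph{localized} in a region $R$ if every gauge operator of linear size at most $\ell_G$ that it violates is supported in $R$. A \emph{gauge twist} is a homomorphism $\Gamma:\mathcal G\to U(1)$ that is trivial on phases and localized in some bounded region. Each $P\in\mathcal P$ defines a gauge twist $\Phi_P(G)=PGP^\dagger G^\dagger$. An \emph{anyon type} is a class of gauge twists modulo $\{\Phi_P:P\in\mathcal P\}$; anyon types form an abelian group (fusion), whose identity is the trivial anyon type. An anyon type is \emph{detectable} if every gauge twist representing it violates at least one stabilizer. A \emph{string operator of width $w$} moving $a$ along a path $\gamma$ from $p$ to $p'$ is a Pauli operator $W$ supported within distance $w$ of $\gamma$ with $\Phi_W=\Gamma'\cdot\Gamma^{-1}$, where $\Gamma'$ and $\Gamma$ are gauge twists representing $a$ that are localized within distance $w$ of $p'$ and of $p$, respectively. A phase $\beta\in U(1)$ is the \emph{braiding phase} $B(a,b)$ if there is $w_0$ such that for every $w\ge w_0$ there is $L_0$ such that for every $L\ge L_0$: there exist string operators of width $w$ moving $a$ along the horizontal segment from $(-L,0)$ to $(L,0)$ and moving $b$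 along the vertical segment from $(0,-L)$ to $(0,L)$, and any two such operators $W^a$, $W^b$ satisfy $W^bW^a=\beta\,W^aW^b$. The anyon type $a$ is \emph{opaque} (it braids nontrivially with some anyon type) if $B(a,b)$ exists and $B(a,b)\neq 1$ for some anyon type $b$. \textbf{Proposition.} Consider a two-dimensional translation-invariant topological subsystem code with finitely many anyon types. Then every detectable anyon type is opaque. Moreover, if the code is a topological stabilizer code, then its anyon theory is modular: every nontrivial anyon type is opaque. -/

import Mathlib

noncomputable section

set_option linter.unusedSectionVars false

namespace TopSubsystem

/-- Unit cells of the infinite plane. -/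
abbrev Cell : Type := ℤ × ℤ

/-- The sup-norm ball of radius `w` around the cell `p`. -/
def box (p : Cell) (w : ℕ) : Set Cell :=
  {s | |s.1 - p.1| ≤ w ∧ |s.2 - p.2| ≤ w}

/-- The set of cells at sup-distance at most `w` from `γ`. -/
def thicken (γ : Set Cell) (w : ℕ) : Set Cell :=
  {s | ∃ u ∈ γ, s ∈ box u w}

/-- `R` fits into an `ℓ × ℓ` window of cells. -/
def HasLinearSize (ℓ : ℕ) (R : Set Cell) : Prop :=
  ∃ p : Cell, ∀ s ∈ R, (p.1 ≤ s.1 ∧ s.1 < p.1 + ℓ) ∧ (p.2 ≤ s.2 ∧ s.2 < p.2 + ℓ)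

variable {Q : Type} [Fintype Q]

/-- Exponent vectors: finitely many nonzero exponents, the qudit `q` of a cell having dimension
`d q`. -/
abbrev Expo (d : Q → ℕ) : Type := Cell →₀ (∀ q : Q, ZMod (d q))

/-- The phase `∏ ω_q ^ (z_{c,q} * x_{c,q})`, with `ω_q = exp (2 π i / d q)`, picked up when
`Z ^ z` is moved to the right through `X ^ x`. -/
def pairing {d : Q → ℕ} [∀ q, NeZero (d q)] (z x : Expo d) : Circle :=
  z.prod fun c zc => ∏ q, ZMod.toCircle (zc q * x c q)

section pairing

variable {d : Q → ℕ} [∀ q, NeZero (d q)]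

theorem pairing_zero_left (x : Expo d) : pairing 0 x = 1 := rfl

theorem pairing_zero_right (z : Expo d) : pairing z 0 = 1 := by
  simp [pairing, Finsupp.prod]

theorem pairing_add_left (z z' x : Expo d) :
    pairing (z + z') x = pairing z x * pairing z' x := by
  unfold pairing
  apply Finsupp.prod_add_index'
  · intro c; simp
  · intro c u v
    simp [add_mul, AddChar.map_add_eq_mul, Finset.prod_mul_distrib]

theorem pairing_add_right (z x x' : Expo d) :
    pairing z (x + x') = pairing z x * pairing z x' := by
  simp [pairing, Finsupp.prod, mul_add, AddChar.map_add_eq_mul, Finset.prod_mul_distrib]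

theorem pairing_neg_left (z x : Expo d) : pairing (-z) x = (pairing z x)⁻¹ := by
  apply eq_inv_of_mul_eq_one_left
  rw [← pairing_add_left, neg_add_cancel, pairing_zero_left]

theorem pairing_neg_right (z x : Expo d) : pairing z (-x) = (pairing z x)⁻¹ := by
  apply eq_inv_of_mul_eq_one_left
  rw [← pairing_add_right, neg_add_cancel, pairing_zero_right]

theorem pairing_eq_one_of_disjoint (z x : Expo d) (h : ∀ c, z c = 0 ∨ x c = 0) :
    pairing z x = 1 := by
  unfold pairing Finsupp.prod
  apply Finset.prod_eq_one
  intro c _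
  rcases h c with h | h <;> simp [h]

end pairing

/-- The Pauli operator `phase • X ^ x * Z ^ z` on the infinite plane: a product of finitely many
single-site operators `X` and `Z` (where `X |α⟩ = |α + 1⟩` and `Z |α⟩ = ω ^ α |α⟩`) and a
`U(1)` phase. Every such operator has a unique normal form of this shape. -/
@[ext]
structure Pauli (d : Q → ℕ) where
  phase : Circle
  x : Expo d
  z : Expo d

namespace Pauli

variable {d : Q → ℕ} [∀ q, NeZero (d q)]

/-- Composition of operators, from `Z ^ z * X ^ x = pairing z x • X ^ x * Z ^ z`. -/
instance : Mul (Pauli d) :=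
  ⟨fun P P' => ⟨P.phase * P'.phase * pairing P.z P'.x, P.x + P'.x, P.z + P'.z⟩⟩

instance : One (Pauli d) := ⟨⟨1, 0, 0⟩⟩

instance : Inv (Pauli d) := ⟨fun P => ⟨P.phase⁻¹ * pairing P.z P.x, -P.x, -P.z⟩⟩

theorem mul_def (P P' : Pauli d) :
    P * P' = ⟨P.phase * P'.phase * pairing P.z P'.x, P.x + P'.x, P.z + P'.z⟩ := rfl

theorem one_def : (1 : Pauli d) = ⟨1, 0, 0⟩ := rfl

theorem inv_def (P : Pauli d) : P⁻¹ = ⟨P.phase⁻¹ * pairing P.z P.x, -P.x, -P.z⟩ := rfl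

instance : Group (Pauli d) :=
  Group.ofLeftAxioms
    (by
      intro P P' P''
      simp only [mul_def, pairing_add_left, pairing_add_right, mk.injEq, add_assoc, and_self,
        and_true]
      simp only [mul_assoc, mul_left_comm, mul_comm])
    (by intro P; simp [mul_def, one_def, pairing_zero_left])
    (by
      intro P
      simp [mul_def, one_def, inv_def, pairing_neg_left])

/-- The multiples of the identity. -/
def ofPhase : Circle →* Pauli d where
  toFun c := ⟨c, 0, 0⟩
  map_one' := rfl
  map_mul' c c' := by simp [mul_def, pairing_zero_left]

variable (d) in
/-- The group `U(1)` of multiples of the identity. -/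
def phases : Subgroup (Pauli d) := (ofPhase (d := d)).range

/-- The cells on which a Pauli operator acts by more than a phase. -/
def supp (P : Pauli d) : Set Cell := {c | P.x c ≠ 0 ∨ P.z c ≠ 0}

/-- Translation by the lattice vector `t`. -/
def translate (t : Cell) (P : Pauli d) : Pauli d :=
  ⟨P.phase, P.x.equivMapDomain (Equiv.addRight t), P.z.equivMapDomain (Equiv.addRight t)⟩

/-- The phase `P * G * P⁻¹ * G⁻¹`. -/
def commPhase (P G : Pauli d) : Circle := (P * G * P⁻¹ * G⁻¹).phase

theorem commPhase_eq (P G : Pauli d) :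
    commPhase P G = pairing P.z G.x * (pairing G.z P.x)⁻¹ := by
  simp only [commPhase, mul_def, inv_def, pairing_add_left, pairing_neg_left,
    pairing_neg_right]
  apply Additive.ofMul.injective
  simp only [ofMul_mul, ofMul_inv]
  abel

/-- The group commutator of two Pauli operators is the multiple `commPhase` of the identity. -/
theorem commutator_eq_ofPhase (P G : Pauli d) :
    P * G * P⁻¹ * G⁻¹ = ofPhase (commPhase P G) := by
  ext1
  · rfl
  · simp [mul_def, inv_def, ofPhase]
  · simp [mul_def, inv_def, ofPhase]

theorem commPhase_mul_left (P P' G : Pauli d) :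
    commPhase (P * P') G = commPhase P G * commPhase P' G := by
  simp only [commPhase_eq, mul_def, pairing_add_left, pairing_add_right, mul_inv_rev]
  ac_rfl

theorem commPhase_mul_right (P G G' : Pauli d) :
    commPhase P (G * G') = commPhase P G * commPhase P G' := by
  simp only [commPhase_eq, mul_def, pairing_add_left, pairing_add_right, mul_inv_rev]
  ac_rfl

theorem commPhase_one_left (G : Pauli d) : commPhase 1 G = 1 := by
  simp [commPhase_eq, one_def, pairing_zero_left, pairing_zero_right]

theorem commPhase_one_right (P : Pauli d) : commPhase P 1 = 1 := by
  simp [commPhase_eq, one_def, pairing_zero_left, pairing_zero_right]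

theorem commPhase_ofPhase_right (P : Pauli d) (c : Circle) : commPhase P (ofPhase c) = 1 := by
  simp [commPhase_eq, ofPhase, pairing_zero_left, pairing_zero_right]

theorem commPhase_eq_one_of_disjoint (P G : Pauli d) (h : ∀ c ∈ P.supp, c ∉ G.supp) :
    commPhase P G = 1 := by
  have h' : ∀ c, (P.x c = 0 ∧ P.z c = 0) ∨ (G.x c = 0 ∧ G.z c = 0) := by
    intro c
    have := h c
    simp only [supp, Set.mem_ofPred_eq] at this
    tauto
  rw [commPhase_eq, pairing_eq_one_of_disjoint, pairing_eq_one_of_disjoint]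
  · simp
  · intro c; have := h' c; tauto
  · intro c; have := h' c; tauto

theorem supp_subset_box (P : Pauli d) : ∃ r : ℕ, P.supp ⊆ box 0 r := by
  classical
  refine ⟨(P.x.support ∪ P.z.support).sup fun c => c.1.natAbs + c.2.natAbs, ?_⟩
  intro c hc
  have hc' : c ∈ P.x.support ∪ P.z.support := by simpa [supp] using hc
  have := Finset.le_sup (f := fun c : Cell => c.1.natAbs + c.2.natAbs) hc'
  simp only [box, Set.mem_ofPred_eq, Prod.fst_zero, Prod.snd_zero, sub_zero, Int.abs_eq_natAbs]
  constructor <;> norm_cast <;> refine le_trans ?_ this <;> simp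

end Pauli

open Pauli in
/-- A (Pauli) subsystem code: a gauge group, taken to contain all phases, and a stabilizer group,
which is a group of commuting Pauli operators containing no multiple of the identity other than
the identity, and equals the center of the gauge group up to phases. -/
structure SubsystemCode (d : Q → ℕ) [∀ q, NeZero (d q)] where
  /-- the gauge group `𝒢` -/
  gauge : Subgroup (Pauli d)
  /-- the stabilizer group `𝒮` -/
  stab : Subgroup (Pauli d)
  phases_le_gauge : phases d ≤ gauge
  stab_inf_phases : stab ⊓ phases d = ⊥
  center_gauge : gauge ⊓ Subgroup.centralizer (gauge : Set (Pauli d)) = stab ⊔ phases d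

/-- A two-dimensional translation-invariant topological subsystem code, on the infinite plane. -/
structure TopologicalSubsystemCode (d : Q → ℕ) [∀ q, NeZero (d q)] extends SubsystemCode d where
  /-- bound on the linear size of the gauge generators -/
  sizeG : ℕ
  /-- bound on the linear size of the stabilizer generators -/
  sizeS : ℕ
  translation_invariant : ∀ (t : Cell), ∀ g ∈ gauge, g.translate t ∈ gauge
  gauge_local :
    Subgroup.closure {g : Pauli d | g ∈ gauge ∧ HasLinearSize sizeG g.supp} = gauge
  stab_local :
    Subgroup.closure {s : Pauli d | s ∈ stab ∧ HasLinearSize sizeS s.supp} = stab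
  centralizer_stab : Subgroup.centralizer (stab : Set (Pauli d)) = gauge

namespace TopologicalSubsystemCode

variable {d : Q → ℕ} [∀ q, NeZero (d q)] (C : TopologicalSubsystemCode d)

/-- The code is a stabilizer code: the gauge group is the stabilizer group up to phases. -/
def IsStabilizerCode : Prop := C.gauge = C.stab ⊔ Pauli.phases d

/-- `Γ` violates only those local gauge generators that are supported on `R`. As local generators
we take all the gauge operators of linear size at most `sizeG`. -/
def LocalizedIn (Γ : C.gauge →* Circle) (R : Set Cell) : Prop :=
  ∀ g : C.gauge, HasLinearSize C.sizeG (g : Pauli d).supp → Γ g ≠ 1 → (g : Pauli d).supp ⊆ R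

/-- The group of gauge twists: homomorphisms `𝒢 → U(1)`, trivial on multiples of the identity,
which violate only local gauge generators in some bounded region (equivalently, only finitely many
of them up to phases). -/
def gaugeTwists : Subgroup (C.gauge →* Circle) where
  carrier := {Γ | (∀ g : C.gauge, (g : Pauli d) ∈ Pauli.phases d → Γ g = 1) ∧
    ∃ r : ℕ, C.LocalizedIn Γ (box 0 r)}
  one_mem' := ⟨fun _ _ => rfl, 0, fun _ _ h => (h rfl).elim⟩
  mul_mem' := by
    rintro Γ Γ' ⟨h, r, hr⟩ ⟨h', r', hr'⟩
    refine ⟨fun g hg => by simp [h g hg, h' g hg], max r r', ?_⟩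
    intro g hg hne
    have hmono : ∀ {m n : ℕ}, m ≤ n → box 0 m ⊆ box 0 n := by
      intro m n hmn s hs
      have : (m : ℤ) ≤ n := by exact_mod_cast hmn
      exact ⟨hs.1.trans this, hs.2.trans this⟩
    by_cases h1 : Γ g = 1
    · have h2 : Γ' g ≠ 1 := by
        intro h2; apply hne; simp [h1, h2]
      exact (hr' g hg h2).trans (hmono (le_max_right _ _))
    · exact (hr g hg h1).trans (hmono (le_max_left _ _))
  inv_mem' := by
    rintro Γ ⟨h, r, hr⟩
    refine ⟨fun g hg => by simp [h g hg], r, ?_⟩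
    intro g hg hne
    exact hr g hg (by simpa using hne)

/-- The gauge twist `Φ_P : G ↦ P * G * P⁻¹ * G⁻¹` of a Pauli operator `P`, as a homomorphism
in `P`. -/
def pauliTwist : Pauli d →* C.gaugeTwists where
  toFun P := ⟨
    { toFun := fun g => Pauli.commPhase P g
      map_one' := Pauli.commPhase_one_right P
      map_mul' := fun g g' => Pauli.commPhase_mul_right P g g' }, by
    constructor
    · rintro ⟨g, hg⟩ ⟨c, hc⟩
      simp only at hc
      subst hc
      exact Pauli.commPhase_ofPhase_right P c
    · obtain ⟨r, hr⟩ := P.supp_subset_box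
      refine ⟨r + C.sizeG, ?_⟩
      rintro g ⟨p, hp⟩ hne s hs
      have hmeet : ∃ c ∈ P.supp, c ∈ (g : Pauli d).supp := by
        by_contra hcon
        push Not at hcon
        exact hne (Pauli.commPhase_eq_one_of_disjoint P g hcon)
      obtain ⟨c, hcP, hcg⟩ := hmeet
      have h1 := hr hcP
      have h2 := hp c hcg
      have h3 := hp s hs
      simp only [box, Set.mem_ofPred_eq, Prod.fst_zero, Prod.snd_zero, sub_zero, abs_le] at h1 ⊢
      push_cast
      omega⟩
  map_one' := by
    apply Subtype.ext
    ext g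
    simp [Pauli.commPhase_one_left]
  map_mul' P P' := by
    apply Subtype.ext
    ext g
    simp [Pauli.commPhase_mul_left]

/-- Anyon types: gauge twists modulo the twists `Φ_P` of Pauli operators, with fusion as
multiplication and the trivial anyon type as `1`. -/
abbrev AnyonType : Type := C.gaugeTwists ⧸ C.pauliTwist.range

/-- The anyon type represented by a gauge twist. -/
def anyonType (Γ : C.gaugeTwists) : C.AnyonType := QuotientGroup.mk Γ

/-- An anyon type is detectable if each of its gauge twists violates some stabilizer. -/
def IsDetectable (a : C.AnyonType) : Prop :=
  ∀ Γ : C.gaugeTwists, C.anyonType Γ = a →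
    ∃ g : C.gauge, (g : Pauli d) ∈ C.stab ∧ (Γ : C.gauge →* Circle) g ≠ 1

/-- `W` is a string operator of width parameter `w` moving the anyon type `a` along the path `γ`
from `tail` to `head`: it is supported within distance `w` of `γ`, and its commutation relations
with the gauge operators are those of a representative of `a` near `head` times the inverse of a
representative of `a` near `tail`. -/
def IsStringOperator (a : C.AnyonType) (γ : Set Cell) (tail head : Cell) (w : ℕ)
    (W : Pauli d) : Prop :=
  W.supp ⊆ thicken γ w ∧
  ∃ Γh Γt : C.gaugeTwists,
    C.anyonType Γh = a ∧ C.LocalizedIn Γh (box head w) ∧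
    C.anyonType Γt = a ∧ C.LocalizedIn Γt (box tail w) ∧
    C.pauliTwist W = Γh * Γt⁻¹

/-- String operators moving `a` from left to right along the horizontal axis. -/
def IsHorizontalString (a : C.AnyonType) (L w : ℕ) (W : Pauli d) : Prop :=
  C.IsStringOperator a {s | |s.1| ≤ L ∧ s.2 = 0} (-(L : ℤ), 0) ((L : ℤ), 0) w W

/-- String operators moving `a` upwards along the vertical axis. -/
def IsVerticalString (a : C.AnyonType) (L w : ℕ) (W : Pauli d) : Prop :=
  C.IsStringOperator a {s | s.1 = 0 ∧ |s.2| ≤ L} (0, -(L : ℤ)) (0, (L : ℤ)) w W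

/-- `β` is the braiding phase `B(a, b)`: whenever the width parameter `w` is large enough, and then
the length `L` is large enough, there are string operators `W` for `a` (horizontal) and `W'` for `b`
(vertical), which cross once, and all of them satisfy `W' W = β W W'`. -/
def IsBraidingPhase (a b : C.AnyonType) (β : Circle) : Prop :=
  ∃ w₀ : ℕ, ∀ w ≥ w₀, ∃ L₀ : ℕ, ∀ L ≥ L₀,
    (∃ W, C.IsHorizontalString a L w W) ∧ (∃ W', C.IsVerticalString b L w W') ∧
    ∀ W W', C.IsHorizontalString a L w W → C.IsVerticalString b L w W' →
      W' * W = Pauli.ofPhase β * (W * W')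

/-- Opaque anyon types: those that braid nontrivially with some anyon type. -/
def IsOpaque (a : C.AnyonType) : Prop :=
  ∃ (b : C.AnyonType) (β : Circle), C.IsBraidingPhase a b β ∧ β ≠ 1

/-- The anyon theory is modular: every nontrivial anyon type braids nontrivially with some anyon
type. -/
def IsModular : Prop := ∀ a : C.AnyonType, a ≠ 1 → C.IsOpaque a

end TopologicalSubsystemCode

end TopSubsystem

end

/-! Modulo phases, Pauli operators are finitely supported configurations with values in a finite
abelian group, and commutation phases become a bilinear form. A code becomes a `LatticeCode`, whose
stabilizers are exactly the operators commuting with the whole gauge group.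

Braiding phases exist because there are finitely many types. By pigeonhole, a twist has the same
type as some translate of itself (`exists_period`), and translates of the Pauli operator relating
the two combine into strings of fixed width and any length. Two strings of the same type with the
same ends differ, up to corrections near the ends, by a stabilizer. A transversal string commutes
with that stabilizer, since its ends can be pushed arbitrarily far away without changing it near the
crossing (`IsMover.exists_escape`). So the phase depends neither on the strings nor on their length
(`exists_braiding`).

Detectable types braid nontrivially. On the stabilizers, a detectable twist `Γ` acts unlike any
Pauli operator. Characters of the operators on a finite region come from Pauli operators, so `Γ` is
nontrivial on stabilizers vanishing on arbitrarily large boxes. Discarding factors far from `Γ`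
leaves a stabilizer on a thin annulus on which `Γ` is nontrivial (`exists_annulus`). A string of the
type of `Γ` from the center of the annulus to the outside fails to commute with it, and meets only
one of its sides. That side, cut out of the annulus, violates gauge generators only near its two
ends.

For the side to be a string operator, its twist must split into one twist at each end
(`exists_splitting`). The relations between translates of the gauge generators form a module over
the Noetherian ring `ℤ[ℤ²]`, so they are generated by relations of bounded size, and switching off
one of two distant ends respects these. The resulting type may depend on the size of the annulus,
but finiteness of the set of types provides a size at which all braiding phases are valid
(`exists_braiding_ne_zero`).

In a stabilizer code, a twist violating no stabilizer is trivial, so every nontrivial type is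
detectable. -/

noncomputable section

set_option linter.unusedSectionVars false

namespace TopSubsystem

/-! ### Configurations on the lattice and the commutation form. -/

section Configurations

variable {M : Type} [AddCommGroup M]

/-- The configurations vanishing outside `R`. -/
def supportedIn (M : Type) [AddCommGroup M] (R : Set Cell) : AddSubgroup (Cell →₀ M) where
  carrier := {v | ∀ c, v c ≠ 0 → c ∈ R}
  zero_mem' := fun c h => (h rfl).elim
  add_mem' := by
    intro u v hu hv c h
    by_cases h1 : u c = 0
    · exact hv c fun h2 => h (by simp [h1, h2])
    · exact hu c h1
  neg_mem' := by
    intro u hu c h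
    exact hu c (by simpa using h)

theorem mem_supportedIn {R : Set Cell} {v : Cell →₀ M} :
    v ∈ supportedIn M R ↔ ∀ c, v c ≠ 0 → c ∈ R := Iff.rfl

theorem supportedIn_mono {R R' : Set Cell} (h : R ⊆ R') : supportedIn M R ≤ supportedIn M R' :=
  fun _ hv c hc => h (hv c hc)

theorem mem_box {s p : Cell} {w : ℕ} :
    s ∈ box p w ↔ (p.1 - w ≤ s.1 ∧ s.1 ≤ p.1 + w) ∧ (p.2 - w ≤ s.2 ∧ s.2 ≤ p.2 + w) := by
  simp only [box, Set.mem_ofPred_eq, abs_le]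
  omega

theorem box_mono {p : Cell} {w w' : ℕ} (h : w ≤ w') : box p w ⊆ box p w' := by
  intro s hs
  rw [mem_box] at *
  omega

theorem finite_box (p : Cell) (w : ℕ) : (box p w).Finite := by
  refine ((Set.finite_Icc (p.1 - w) (p.1 + w)).prod (Set.finite_Icc (p.2 - w) (p.2 + w))).subset ?_
  intro s hs
  rw [mem_box] at hs
  exact ⟨hs.1, hs.2⟩

theorem exists_mem_supportedIn_box (v : Cell →₀ M) : ∃ r : ℕ, v ∈ supportedIn M (box 0 r) := by
  refine ⟨v.support.sup fun c => c.1.natAbs + c.2.natAbs, fun c hc => ?_⟩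
  have := Finset.le_sup (f := fun c : Cell => c.1.natAbs + c.2.natAbs) (Finsupp.mem_support_iff.2 hc)
  rw [mem_box]
  simp only [Prod.fst_zero, Prod.snd_zero]
  omega

theorem finite_supportedIn [Finite M] {R : Set Cell} (hR : R.Finite) :
    Finite (supportedIn M R) := by
  have := hR.to_subtype
  refine Finite.of_injective (fun (v : supportedIn M R) (c : R) => v.1 c) ?_
  intro u v h
  ext c
  by_cases hc : c ∈ R
  · exact congrFun h ⟨c, hc⟩
  · rw [not_not.1 fun h' => hc (u.2 c h'), not_not.1 fun h' => hc (v.2 c h')]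

/-- Translation of configurations by the lattice vector `t`. -/
def shift (t : Cell) : (Cell →₀ M) ≃+ (Cell →₀ M) := Finsupp.domCongr (Equiv.addRight t)

@[simp] theorem shift_apply (t : Cell) (v : Cell →₀ M) (c : Cell) : shift t v c = v (c - t) := by
  simp [shift, Finsupp.domCongr, sub_eq_add_neg]

@[simp] theorem shift_zero (v : Cell →₀ M) : shift 0 v = v := by
  ext c; simp

theorem shift_shift (s t : Cell) (v : Cell →₀ M) : shift s (shift t v) = shift (s + t) v := by
  ext c; simp [sub_sub]

theorem shift_mem_box {t p : Cell} {w : ℕ} {v : Cell →₀ M} (h : v ∈ supportedIn M (box p w)) :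
    shift t v ∈ supportedIn M (box (p + t) w) := by
  intro c hc
  have := h _ (by simpa using hc)
  rw [mem_box] at *
  simp only [Prod.fst_sub, Prod.snd_sub, Prod.fst_add, Prod.snd_add] at *
  omega

/-- `v` is supported in some `ℓ × ℓ` window. -/
def IsSmall (ℓ : ℕ) (v : Cell →₀ M) : Prop := HasLinearSize ℓ {c | v c ≠ 0}

theorem IsSmall.shift {ℓ : ℕ} {v : Cell →₀ M} (h : IsSmall ℓ v) (t : Cell) :
    IsSmall ℓ (shift t v) := by
  obtain ⟨p, hp⟩ := h
  refine ⟨p + t, fun c hc => ?_⟩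
  have := hp (c - t) (by simpa using hc)
  simp only [Prod.fst_sub, Prod.snd_sub, Prod.fst_add, Prod.snd_add] at *
  omega

theorem IsSmall.exists_box {ℓ : ℕ} {v : Cell →₀ M} (h : IsSmall ℓ v) :
    ∃ p, v ∈ supportedIn M (box p ℓ) := by
  obtain ⟨p, hp⟩ := h
  refine ⟨p, fun c hc => ?_⟩
  have := hp c hc
  rw [mem_box]
  omega

theorem IsSmall.dist_le {ℓ : ℕ} {v : Cell →₀ M} (h : IsSmall ℓ v) {c c' : Cell} (hc : v c ≠ 0)
    (hc' : v c' ≠ 0) : c' ∈ box c ℓ := by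
  obtain ⟨p, hp⟩ := h
  have h1 := hp c hc
  have h2 := hp c' hc'
  rw [mem_box]
  omega

/-- The bilinear form on configurations which sums the local form `ω` over all cells. -/
def form (ω : M →+ M →+ Additive Circle) :
    (Cell →₀ M) →+ (Cell →₀ M) →+ Additive Circle :=
  Finsupp.liftAddHom fun c => (AddMonoidHom.compHom'  (Finsupp.applyAddHom c)).comp ω

variable (ω : M →+ M →+ Additive Circle)

theorem form_apply (u v : Cell →₀ M) : form ω u v = u.sum fun c m => ω m (v c) := by
  simp [form, Finsupp.sum, AddMonoidHom.finsetSum_apply]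

theorem form_single (c : Cell) (m : M) (v : Cell →₀ M) :
    form ω (Finsupp.single c m) v = ω m (v c) := by
  rw [form_apply, Finsupp.sum_single_index (by simp)]

theorem form_eq_zero {u v : Cell →₀ M} (h : ∀ c, u c ≠ 0 → v c ≠ 0 → False) :
    form ω u v = 0 := by
  rw [form_apply]
  refine Finset.sum_eq_zero fun c hc => ?_
  have : v c = 0 := not_not.1 fun h' => h c (Finsupp.mem_support_iff.1 hc) h'
  simp [this]

theorem form_eq_zero_of_disjoint {R R' : Set Cell} {u v : Cell →₀ M}
    (hu : u ∈ supportedIn M R) (hv : v ∈ supportedIn M R') (h : ∀ c ∈ R, c ∉ R') :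
    form ω u v = 0 :=
  form_eq_zero ω fun c h1 h2 => h c (hu c h1) (hv c h2)

theorem form_antisymm (hω : ∀ a b, ω a b = - ω b a) (u v : Cell →₀ M) :
    form ω u v = - form ω v u := by
  have : form ω u v = ∑ c ∈ u.support ∪ v.support, ω (u c) (v c) := by
    rw [form_apply]
    exact Finsupp.sum_of_support_subset _ Finset.subset_union_left _ (by simp)
  have h' : form ω v u = ∑ c ∈ u.support ∪ v.support, ω (v c) (u c) := by
    rw [form_apply]
    exact Finsupp.sum_of_support_subset _ Finset.subset_union_right _ (by simp)
  rw [this, h', ← Finset.sum_neg_distrib]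
  exact Finset.sum_congr rfl fun c _ => hω _ _

theorem form_shift (t : Cell) (u v : Cell →₀ M) :
    form ω (shift t u) (shift t v) = form ω u v := by
  rw [form_apply, form_apply]
  simp only [shift, Finsupp.domCongr_apply]
  rw [Finsupp.equivMapDomain_eq_mapDomain, Finsupp.sum_mapDomain_index_inj (Equiv.injective _)]
  simp

theorem form_shift_left (t : Cell) (u v : Cell →₀ M) :
    form ω (shift t u) v = form ω u (shift (-t) v) := by
  rw [← form_shift ω t u, shift_shift, add_neg_cancel, shift_zero]

end Configurations

end TopSubsystem

/-! ### Codes up to phases, gauge twists, and translation-uniform radii. -/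

namespace TopSubsystem

/-- A translation-invariant topological subsystem code up to phases: Pauli operators are
configurations with values in a finite abelian group with a perfect antisymmetric form. -/
structure LatticeCode (M : Type) [AddCommGroup M] where
  /-- commutation phases of the Pauli operators of a cell -/
  local_form : M →+ M →+ Additive Circle
  local_form_antisymm : ∀ a b, local_form a b = - local_form b a
  exists_local_form_eq : ∀ χ : M →+ Additive Circle, ∃ m, ∀ x, local_form m x = χ x
  /-- gauge operators -/
  gauge : AddSubgroup (Cell →₀ M)
  /-- stabilizers -/
  stab : AddSubgroup (Cell →₀ M)
  /-- bound on the linear size of the gauge generators -/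
  sizeG : ℕ
  /-- bound on the linear size of the stabilizer generators -/
  sizeS : ℕ
  shift_mem_gauge : ∀ (t : Cell), ∀ g ∈ gauge, shift t g ∈ gauge
  gauge_local : AddSubgroup.closure {g | g ∈ gauge ∧ IsSmall sizeG g} = gauge
  stab_local : AddSubgroup.closure {s | s ∈ stab ∧ IsSmall sizeS s} = stab
  stab_le_gauge : stab ≤ gauge
  mem_stab_iff : ∀ s, s ∈ stab ↔ ∀ g ∈ gauge, form local_form s g = 0

namespace LatticeCode

variable {M : Type} [AddCommGroup M] (C : LatticeCode M)

/-- The commutation form of the code. -/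
abbrev σ : (Cell →₀ M) →+ (Cell →₀ M) →+ Additive Circle := form C.local_form

/-- Translation invariance is assumed of the gauge group only; the stabilizers inherit it as its
commutant. -/
theorem shift_mem_stab (t : Cell) {s : Cell →₀ M} (hs : s ∈ C.stab) : shift t s ∈ C.stab := by
  rw [C.mem_stab_iff] at *
  intro g hg
  rw [form_shift_left]
  exact hs _ (C.shift_mem_gauge _ _ hg)

/-- Homomorphisms from the gauge group to the circle group, the candidate gauge twists. -/
abbrev GaugeHom : Type := C.gauge →+ Additive Circle

/-- Every small gauge operator violated by `Γ` is supported in `R`. -/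
def LocalizedIn (Γ : C.GaugeHom) (R : Set Cell) : Prop :=
  ∀ g : C.gauge, IsSmall C.sizeG (g : Cell →₀ M) → Γ g ≠ 0 → (g : Cell →₀ M) ∈ supportedIn M R

variable {C} in
theorem LocalizedIn.mono {Γ : C.GaugeHom} {R R' : Set Cell} (h : C.LocalizedIn Γ R)
    (hR : R ⊆ R') : C.LocalizedIn Γ R' :=
  fun g hg hne => supportedIn_mono hR (h g hg hne)

theorem localizedIn_zero (R : Set Cell) : C.LocalizedIn 0 R := fun _ _ h => (h rfl).elim

variable {C} in
theorem LocalizedIn.add {Γ Γ' : C.GaugeHom} {R : Set Cell} (h : C.LocalizedIn Γ R)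
    (h' : C.LocalizedIn Γ' R) : C.LocalizedIn (Γ + Γ') R := by
  intro g hg hne
  by_cases h1 : Γ g = 0
  · exact h' g hg fun h2 => hne (by simp [h1, h2])
  · exact h g hg h1

variable {C} in
theorem LocalizedIn.neg {Γ : C.GaugeHom} {R : Set Cell} (h : C.LocalizedIn Γ R) :
    C.LocalizedIn (-Γ) R :=
  fun g hg hne => h g hg (by simpa using hne)

variable {C} in
theorem LocalizedIn.sub {Γ Γ' : C.GaugeHom} {R : Set Cell} (h : C.LocalizedIn Γ R)
    (h' : C.LocalizedIn Γ' R) : C.LocalizedIn (Γ - Γ') R :=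
  sub_eq_add_neg Γ Γ' ▸ h.add h'.neg

/-- The gauge twists. -/
def twists : AddSubgroup C.GaugeHom where
  carrier := {Γ | ∃ r : ℕ, C.LocalizedIn Γ (box 0 r)}
  zero_mem' := ⟨0, C.localizedIn_zero _⟩
  add_mem' := by
    rintro Γ Γ' ⟨r, hr⟩ ⟨r', hr'⟩
    exact ⟨max r r', (hr.mono (box_mono (le_max_left _ _))).add
      (hr'.mono (box_mono (le_max_right _ _)))⟩
  neg_mem' := by
    rintro Γ ⟨r, hr⟩
    exact ⟨r, hr.neg⟩

variable {C} in
theorem LocalizedIn.mem_twists {Γ : C.GaugeHom} {p : Cell} {w : ℕ}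
    (h : C.LocalizedIn Γ (box p w)) : Γ ∈ C.twists := by
  refine ⟨p.1.natAbs + p.2.natAbs + w, h.mono fun s hs => ?_⟩
  rw [mem_box] at *
  simp only [Prod.fst_zero, Prod.snd_zero]
  omega

/-- The gauge twist of a Pauli operator. -/
def twist : (Cell →₀ M) →+ C.GaugeHom :=
  (AddMonoidHom.compHom' C.gauge.subtype).comp C.σ

@[simp] theorem twist_apply (P : Cell →₀ M) (g : C.gauge) : C.twist P g = C.σ P g := rfl

/-- Anyon types. -/
abbrev Anyon : Type := C.twists ⧸ C.twist.range.addSubgroupOf C.twists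

/-- Gauge twists of the same anyon type. -/
def Equivalent (Γ Γ' : C.GaugeHom) : Prop := ∃ P, C.twist P = Γ - Γ'

variable {C}

theorem Equivalent.symm {Γ Γ' : C.GaugeHom} (h : C.Equivalent Γ Γ') : C.Equivalent Γ' Γ := by
  obtain ⟨P, hP⟩ := h
  exact ⟨-P, by rw [map_neg, hP, neg_sub]⟩

theorem Equivalent.trans {Γ Γ' Γ'' : C.GaugeHom} (h : C.Equivalent Γ Γ')
    (h' : C.Equivalent Γ' Γ'') : C.Equivalent Γ Γ'' := by
  obtain ⟨P, hP⟩ := h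
  obtain ⟨P', hP'⟩ := h'
  exact ⟨P + P', by rw [map_add, hP, hP', sub_add_sub_cancel]⟩

theorem Equivalent.refl (Γ : C.GaugeHom) : C.Equivalent Γ Γ := ⟨0, by simp⟩

theorem anyon_eq_iff {Γ Γ' : C.twists} :
    (QuotientAddGroup.mk Γ : C.Anyon) = QuotientAddGroup.mk Γ' ↔
      C.Equivalent (Γ : C.GaugeHom) Γ' := by
  rw [eq_comm, QuotientAddGroup.eq, AddSubgroup.mem_addSubgroupOf]
  simp [Equivalent, neg_add_eq_sub]

/-- Translation of gauge operators. -/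
def gaugeShift (t : Cell) : C.gauge →+ C.gauge where
  toFun g := ⟨shift t g, C.shift_mem_gauge t _ g.2⟩
  map_zero' := by ext1; simp
  map_add' g g' := by ext1; simp

@[simp] theorem coe_gaugeShift (t : Cell) (g : C.gauge) :
    (gaugeShift t g : Cell →₀ M) = shift t (g : Cell →₀ M) := rfl

/-- Translation of gauge twists. -/
def shiftHom (t : Cell) : C.GaugeHom →+ C.GaugeHom := AddMonoidHom.compHom' (gaugeShift (-t))

theorem shiftHom_apply (t : Cell) (Γ : C.GaugeHom) (g : C.gauge) :
    shiftHom t Γ g = Γ (gaugeShift (-t) g) := rfl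

theorem shiftHom_shiftHom (s t : Cell) (Γ : C.GaugeHom) :
    shiftHom s (shiftHom t Γ) = shiftHom (s + t) Γ := by
  ext1 g
  simp only [shiftHom_apply]
  congr 1
  ext1
  simp [shift_shift, add_comm]

@[simp] theorem shiftHom_zero (Γ : C.GaugeHom) : shiftHom 0 Γ = Γ := by
  ext1 g
  simp only [shiftHom_apply]
  congr 1
  ext1
  simp

theorem twist_shift (t : Cell) (P : Cell →₀ M) :
    C.twist (shift t P) = shiftHom t (C.twist P) := by
  ext1 g
  simp [shiftHom_apply, form_shift_left]

theorem LocalizedIn.shiftHom {Γ : C.GaugeHom} {p : Cell} {w : ℕ}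
    (h : C.LocalizedIn Γ (box p w)) (t : Cell) :
    C.LocalizedIn (shiftHom t Γ) (box (p + t) w) := by
  intro g hg hne
  have := shift_mem_box (t := t) (h (gaugeShift (-t) g) (hg.shift _) hne)
  simpa [shift_shift] using this

theorem Equivalent.shiftHom {Γ Γ' : C.GaugeHom} (h : C.Equivalent Γ Γ') (t : Cell) :
    C.Equivalent (shiftHom t Γ) (LatticeCode.shiftHom t Γ') := by
  obtain ⟨P, hP⟩ := h
  exact ⟨shift t P, by rw [twist_shift, hP, map_sub]⟩

/-- Closed strings are stabilizers: this turns the difference of two strings with matching ends into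
a product of gauge generators. -/
theorem mem_stab_of_twist_eq_zero {P : Cell →₀ M} (hP : C.twist P = 0) : P ∈ C.stab :=
  (C.mem_stab_iff P).2 fun g hg => DFunLike.congr_fun hP ⟨g, hg⟩

theorem σ_antisymm (u v : Cell →₀ M) : C.σ u v = - C.σ v u :=
  form_antisymm _ C.local_form_antisymm u v

/-- The small gauge operators supported in `R`. -/
def gensIn (C : LatticeCode M) (R : Set Cell) : Set (Cell →₀ M) :=
  {g | g ∈ C.gauge ∧ IsSmall C.sizeG g ∧ g ∈ supportedIn M R}

theorem gensIn_mono {R R' : Set Cell} (h : R ⊆ R') : C.gensIn R ⊆ C.gensIn R' :=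
  fun _ hg => ⟨hg.1, hg.2.1, supportedIn_mono h hg.2.2⟩

theorem exists_mem_closure_gensIn {g : Cell →₀ M} (hg : g ∈ C.gauge) :
    ∃ r : ℕ, g ∈ AddSubgroup.closure (C.gensIn (box 0 r)) := by
  rw [← C.gauge_local] at hg
  induction hg using AddSubgroup.closure_induction with
  | mem x hx =>
    obtain ⟨r, hr⟩ := exists_mem_supportedIn_box x
    exact ⟨r, AddSubgroup.subset_closure ⟨hx.1, hx.2, hr⟩⟩
  | zero => exact ⟨0, zero_mem _⟩
  | add x y _ _ hx hy =>
    obtain ⟨r, hr⟩ := hx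
    obtain ⟨r', hr'⟩ := hy
    exact ⟨max r r', add_mem
      (AddSubgroup.closure_mono (gensIn_mono (box_mono (le_max_left _ _))) hr)
      (AddSubgroup.closure_mono (gensIn_mono (box_mono (le_max_right _ _))) hr')⟩
  | neg x _ hx =>
    obtain ⟨r, hr⟩ := hx
    exact ⟨r, neg_mem hr⟩

theorem eq_zero_of_mem_closure_gensIn {Γ : C.GaugeHom} {R : Set Cell}
    (h : ∀ g : C.gauge, (g : Cell →₀ M) ∈ C.gensIn R → Γ g = 0) (g : C.gauge)
    (hg : (g : Cell →₀ M) ∈ AddSubgroup.closure (C.gensIn R)) : Γ g = 0 := by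
  have : AddSubgroup.closure (C.gensIn R) ≤ Γ.ker.map C.gauge.subtype := by
    rw [AddSubgroup.closure_le]
    intro x hx
    exact ⟨⟨x, hx.1⟩, h _ hx, rfl⟩
  obtain ⟨g', h1, h2⟩ := this hg
  rw [← Subtype.ext (a1 := g') (a2 := g) h2]
  exact h1

theorem shift_mem_closure_gensIn (t p : Cell) (w : ℕ) {g : Cell →₀ M}
    (hg : g ∈ AddSubgroup.closure (C.gensIn (box p w))) :
    shift t g ∈ AddSubgroup.closure (C.gensIn (box (p + t) w)) := by
  have : AddSubgroup.closure (C.gensIn (box p w)) ≤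
      (AddSubgroup.closure (C.gensIn (box (p + t) w))).comap (shift t).toAddMonoidHom := by
    rw [AddSubgroup.closure_le]
    rintro x ⟨h1, h2, h3⟩
    exact AddSubgroup.subset_closure ⟨C.shift_mem_gauge _ _ h1, h2.shift _, shift_mem_box h3⟩
  exact this hg

/-- Some positive multiple of any translation preserves the type of a given twist. -/
theorem exists_period [Finite C.Anyon] {Γ : C.GaugeHom} (hΓ : Γ ∈ C.twists) (e : Cell) :
    ∃ n : ℕ, 0 < n ∧ C.Equivalent (shiftHom (n • e) Γ) Γ := by
  obtain ⟨r, hr⟩ := hΓ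
  have hmem : ∀ i : ℕ, shiftHom (i • e) Γ ∈ C.twists := fun i => (hr.shiftHom _).mem_twists
  -- Pigeonhole: the infinitely many translates of `Γ` fall into finitely many types.
  obtain ⟨i, j, hij, h⟩ := Finite.exists_ne_map_eq_of_infinite
    fun i : ℕ => (QuotientAddGroup.mk ⟨_, hmem i⟩ : C.Anyon)
  wlog hlt : i < j generalizing i j
  · exact this j i hij.symm h.symm (lt_of_le_of_ne (not_lt.1 hlt) hij.symm)
  refine ⟨j - i, Nat.sub_pos_of_lt hlt, ?_⟩
  have h1 := (anyon_eq_iff.1 h).symm.shiftHom (-(i • e))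
  simp only [shiftHom_shiftHom] at h1
  rw [neg_add_cancel, shiftHom_zero] at h1
  rwa [sub_nsmul _ hlt.le, add_comm]

variable [Finite M]

variable (C) in
/-- Gauge operators supported in a box are generated by the small gauge operators in a larger
box, whose radius depends only on that of the first box. -/
theorem exists_radius_closure_gensIn (m : ℕ) :
    ∃ c : ℕ, ∀ p, ∀ g ∈ C.gauge, g ∈ supportedIn M (box p m) →
      g ∈ AddSubgroup.closure (C.gensIn (box p c)) := by
  -- Only finitely many configurations live in the box at the origin, so one radius serves them all;
  -- translation carries it to every `p`.
  have := finite_supportedIn (M := M) (finite_box 0 m)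
  have key : ∀ g : supportedIn M (box 0 m), ∃ r : ℕ, (g : Cell →₀ M) ∈ C.gauge →
      (g : Cell →₀ M) ∈ AddSubgroup.closure (C.gensIn (box 0 r)) := by
    intro g
    by_cases hg : (g : Cell →₀ M) ∈ C.gauge
    · obtain ⟨r, hr⟩ := exists_mem_closure_gensIn hg
      exact ⟨r, fun _ => hr⟩
    · exact ⟨0, fun h => (hg h).elim⟩
  choose r hr using key
  obtain ⟨c, hc⟩ := (Set.finite_range r).bddAbove
  refine ⟨c, fun p g hg hs => ?_⟩
  have h0 : shift (-p) g ∈ supportedIn M (box 0 m) := by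
    simpa using shift_mem_box (t := -p) hs
  have h1 := AddSubgroup.closure_mono (gensIn_mono (box_mono (hc ⟨_, rfl⟩)))
    (hr ⟨_, h0⟩ (C.shift_mem_gauge _ _ hg))
  simpa [shift_shift] using shift_mem_closure_gensIn p 0 c h1

theorem finite_torsion (n : ℕ) (hn : n ≠ 0) : {u : Additive Circle | n • u = 0}.Finite := by
  have : NeZero n := ⟨hn⟩
  have h : (Set.range fun ζ : rootsOfUnity n Circle => Additive.ofMul ((ζ : Circleˣ) : Circle)).Finite :=
    Set.finite_range _
  refine h.subset fun u hu => ?_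
  have hu' : u.toMul ^ n = 1 := hu
  exact ⟨rootsOfUnity.mkOfPowEq u.toMul hu', by simp⟩

-- The values of a twist are torsion of order dividing the exponent of `M`, hence lie in a finite
-- set. A twist localized in the box is determined by its values on the finitely many gauge
-- operators supported there.
variable (C) in
theorem finite_localizedIn_box (w : ℕ) :
    {Γ : C.GaugeHom | C.LocalizedIn Γ (box 0 w)}.Finite := by
  have hN : AddMonoid.exponent M ≠ 0 := AddMonoid.exponent_ne_zero_of_finite
  set N := AddMonoid.exponent M
  have hfin := (finite_torsion N hN).to_subtype
  have hV : ∀ v : Cell →₀ M, N • v = 0 := by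
    intro v
    ext c
    simpa using AddMonoid.exponent_nsmul_eq_zero (v c)
  have := finite_supportedIn (M := M) (finite_box 0 w)
  let X := {g : C.gauge | (g : Cell →₀ M) ∈ supportedIn M (box 0 w)}
  have hX : Finite X :=
    Finite.of_injective (fun g : X => (⟨g.1.1, g.2⟩ : supportedIn M (box 0 w))) (by
      intro g g' h
      simp only [Subtype.mk.injEq] at h
      exact Subtype.ext (Subtype.ext h))
  let F : C.GaugeHom → X → {u : Additive Circle | N • u = 0} := fun Γ g => ⟨Γ g.1, by
    change N • Γ g.1 = 0
    rw [← map_nsmul]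
    have : N • g.1 = 0 := Subtype.ext (hV _)
    rw [this, map_zero]⟩
  refine Set.Finite.of_finite_image (f := F) (Set.toFinite _) ?_
  intro Γ hΓ Γ' hΓ' h
  rw [← sub_eq_zero]
  ext1 g
  refine eq_zero_of_mem_closure_gensIn (R := Set.univ) ?_ g ?_
  · rintro g ⟨_, hg, -⟩
    by_contra hne
    have hmem := (LocalizedIn.sub hΓ hΓ') g hg hne
    have := congrArg Subtype.val (congrFun h ⟨g, hmem⟩)
    exact hne (sub_eq_zero.2 this)
  · obtain ⟨r, hr⟩ := exists_mem_closure_gensIn g.2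
    exact AddSubgroup.closure_mono (gensIn_mono (Set.subset_univ _)) hr

variable (C) in
/-- Trivial twists localized in a box are twists of Pauli operators supported nearby. -/
theorem exists_radius_trivial (w : ℕ) :
    ∃ R : ℕ, ∀ p Γ, C.LocalizedIn Γ (box p w) → C.Equivalent Γ 0 →
      ∃ P ∈ supportedIn M (box p R), C.twist P = Γ := by
  -- As there are finitely many twists localized in the box at the origin, the Pauli operators
  -- realizing the trivial ones have a common radius, valid at every `p` by translation.
  have := (C.finite_localizedIn_box w).to_subtype
  have key : ∀ Γ : {Γ : C.GaugeHom | C.LocalizedIn Γ (box 0 w)}, ∃ r : ℕ, C.Equivalent Γ.1 0 →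
      ∃ P ∈ supportedIn M (box 0 r), C.twist P = Γ.1 := by
    intro Γ
    by_cases hg : C.Equivalent Γ.1 0
    · obtain ⟨P, hP⟩ := id hg
      obtain ⟨r, hr⟩ := exists_mem_supportedIn_box P
      exact ⟨r, fun _ => ⟨P, hr, by simpa using hP⟩⟩
    · exact ⟨0, fun h => (hg h).elim⟩
  choose r hr using key
  obtain ⟨c, hc⟩ := (Set.finite_range r).bddAbove
  refine ⟨c, fun p Γ hΓ h => ?_⟩
  have h0 : C.LocalizedIn (shiftHom (-p) Γ) (box 0 w) := by
    simpa using hΓ.shiftHom (-p)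
  obtain ⟨P, hP, hP'⟩ := hr ⟨_, h0⟩ (by simpa using h.shiftHom (-p))
  refine ⟨shift p P, supportedIn_mono ?_ (shift_mem_box hP), ?_⟩
  · simpa using box_mono (p := p) (hc ⟨_, rfl⟩)
  · simp [twist_shift, hP', shiftHom_shiftHom]

end LatticeCode

end TopSubsystem

/-! ### String operators and the existence of braiding phases. -/

namespace TopSubsystem

/-- `e` and `f` are the two coordinate directions of the plane, in either order. -/
def IsAxes (e f : Cell) : Prop := (e = (1, 0) ∧ f = (0, 1)) ∨ (e = (0, 1) ∧ f = (1, 0))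

theorem IsAxes.symm {e f : Cell} (h : IsAxes e f) : IsAxes f e := by
  unfold IsAxes at *
  tauto

/-- The coordinate of a cell along the direction `e`. -/
def coord (e s : Cell) : ℤ := e.1 * s.1 + e.2 * s.2

theorem IsAxes.mem_box {e f : Cell} (h : IsAxes e f) {s : Cell} {k : ℤ} {w : ℕ} :
    s ∈ box (k • e) w ↔
      (k - w ≤ coord e s ∧ coord e s ≤ k + w) ∧ (-w ≤ coord f s ∧ coord f s ≤ w) := by
  rcases h with ⟨rfl, rfl⟩ | ⟨rfl, rfl⟩ <;>
  · rw [TopSubsystem.mem_box]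
    simp [coord] <;> omega

theorem IsAxes.mem_box_zero {e f : Cell} (h : IsAxes e f) {s : Cell} {w : ℕ} :
    s ∈ box 0 w ↔
      (-w ≤ coord e s ∧ coord e s ≤ w) ∧ (-w ≤ coord f s ∧ coord f s ≤ w) := by
  simpa using h.mem_box (k := 0) (s := s) (w := w)

/-- The cells within distance `w` of the segment of length `2 * L` centered at the origin in the
direction `e`, where `f` is the other direction. -/
def strip (e f : Cell) (L w : ℕ) : Set Cell :=
  {s | |coord e s| ≤ L + w ∧ |coord f s| ≤ w}

theorem mem_strip {e f s : Cell} {L w : ℕ} : s ∈ strip e f L w ↔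
    ((-L - w ≤ coord e s) ∧ coord e s ≤ L + w) ∧ (-w ≤ coord f s ∧ coord f s ≤ w) := by
  simp only [strip, Set.mem_ofPred_eq, abs_le]
  omega

namespace LatticeCode

variable {M : Type} [AddCommGroup M] (C : LatticeCode M)

/-- String operators of width `w` moving the type of `Γ` from `-L • e` to `L • e`. -/
def IsString (Γ : C.GaugeHom) (e f : Cell) (L w : ℕ) (W : Cell →₀ M) : Prop :=
  W ∈ supportedIn M (strip e f L w) ∧
  ∃ Γh Γt : C.GaugeHom,
    C.Equivalent Γh Γ ∧ C.LocalizedIn Γh (box ((L : ℤ) • e) w) ∧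
    C.Equivalent Γt Γ ∧ C.LocalizedIn Γt (box ((-L : ℤ) • e) w) ∧
    C.twist W = Γh - Γt

/-- `P` moves the gauge twist `Γ` by `n` steps in the direction `e`. -/
structure IsMover (Γ : C.GaugeHom) (e : Cell) (n ρ : ℕ) (P : Cell →₀ M) : Prop where
  pos : 0 < n
  localized : C.LocalizedIn Γ (box 0 ρ)
  mem : P ∈ supportedIn M (box 0 ρ)
  twist_eq : C.twist P = shiftHom ((n : ℤ) • e) Γ - Γ

variable {C}

theorem exists_isMover [Finite C.Anyon] {Γ : C.GaugeHom} (hΓ : Γ ∈ C.twists) (e : Cell) :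
    ∃ n ρ P, C.IsMover Γ e n ρ P := by
  obtain ⟨n, hn, P, hP⟩ := exists_period hΓ e
  obtain ⟨r, hr⟩ := hΓ
  obtain ⟨r', hr'⟩ := exists_mem_supportedIn_box P
  exact ⟨n, max r r', P, hn, hr.mono (box_mono (le_max_left _ _)),
    supportedIn_mono (box_mono (le_max_right _ _)) hr', by rw [hP, natCast_zsmul]⟩

/-- The product of the translates of `P` which moves a twist from `(i * n) • e` to
`((i + m) * n) • e`. -/
def path (P : Cell →₀ M) (n : ℕ) (e : Cell) (i : ℤ) (m : ℕ) : Cell →₀ M :=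
  ∑ k ∈ Finset.range m, shift (((i + k) * n : ℤ) • e) P

theorem path_add (P : Cell →₀ M) (n : ℕ) (e : Cell) (i : ℤ) (m m' : ℕ) :
    path P n e i (m + m') = path P n e i m + path P n e (i + m) m' := by
  simp [path, Finset.sum_range_add, add_assoc]

theorem IsMover.twist_path {Γ : C.GaugeHom} {e : Cell} {n ρ : ℕ} {P : Cell →₀ M}
    (h : C.IsMover Γ e n ρ P) (i : ℤ) (m : ℕ) :
    C.twist (path P n e i m) =
      shiftHom (((i + m) * n : ℤ) • e) Γ - shiftHom ((i * n : ℤ) • e) Γ := by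
  induction m with
  | zero => simp [path]
  | succ m ih =>
    rw [path, Finset.sum_range_succ, map_add, ← path, ih, twist_shift, h.twist_eq, map_sub,
      shiftHom_shiftHom, ← add_zsmul]
    have : (i + m) * n + (n : ℤ) = (i + (m + 1 : ℕ)) * n := by push_cast; ring
    rw [this]
    abel

theorem IsMover.path_mem {Γ : C.GaugeHom} {e f : Cell} (hef : IsAxes e f) {n ρ : ℕ}
    {P : Cell →₀ M} (h : C.IsMover Γ e n ρ P) (i : ℤ) (m : ℕ) :
    path P n e i m ∈ supportedIn M {s | (i * n - ρ ≤ coord e s ∧ coord e s + n ≤ (i + m) * n + ρ) ∧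
      (-ρ ≤ coord f s ∧ coord f s ≤ ρ)} := by
  refine sum_mem fun k hk => supportedIn_mono ?_ (shift_mem_box h.mem)
  intro s hs
  rw [zero_add, hef.mem_box] at hs
  have hk' : (k : ℤ) + 1 ≤ m := by exact_mod_cast Finset.mem_range.1 hk
  have h1 : (i + k) * n + (n : ℤ) ≤ (i + m) * n := by nlinarith
  have h2 : i * n ≤ (i + k) * (n : ℤ) := by nlinarith
  simp only [Set.mem_ofPred_eq]
  omega

/-- The product of translates of `P` along the segment of length `2 * L`. -/
def canonicalString (P : Cell →₀ M) (n : ℕ) (e : Cell) (L : ℕ) : Cell →₀ M :=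
  path P n e (-(L / n : ℕ)) (2 * (L / n))

/-- Canonical strings stop at multiples of `n`, short of `± L` by less than `n`; this is why widths
have to be at least `ρ + n`. -/
theorem div_mul_bounds {n : ℕ} (hn : 0 < n) (L : ℕ) :
    ((L / n : ℕ) * n : ℤ) ≤ L ∧ (L : ℤ) < (L / n : ℕ) * n + n := by
  have h1 := Nat.div_add_mod L n
  have h2 := Nat.mod_lt L hn
  have h3 : (n : ℤ) * (L / n : ℕ) + (L % n : ℕ) = L := by exact_mod_cast h1
  have h4 : ((L % n : ℕ) : ℤ) < n := by exact_mod_cast h2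
  constructor <;> linarith

theorem IsMover.twist_canonicalString {Γ : C.GaugeHom} {e : Cell} {n ρ : ℕ} {P : Cell →₀ M}
    (h : C.IsMover Γ e n ρ P) (L : ℕ) :
    C.twist (canonicalString P n e L) =
      shiftHom (((L / n : ℕ) * n : ℤ) • e) Γ - shiftHom ((-(L / n : ℕ) * n : ℤ) • e) Γ := by
  rw [canonicalString, h.twist_path]
  congr 5
  push_cast
  ring

theorem IsMover.canonicalString_mem {Γ : C.GaugeHom} {e f : Cell} (hef : IsAxes e f) {n ρ : ℕ}
    {P : Cell →₀ M} (h : C.IsMover Γ e n ρ P) (L : ℕ) :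
    canonicalString P n e L ∈ supportedIn M (strip e f L ρ) := by
  refine supportedIn_mono ?_ (h.path_mem hef _ _)
  have h1 := div_mul_bounds h.pos L
  intro s hs
  rw [mem_strip]
  simp only [Set.mem_ofPred_eq] at hs
  push_cast at hs h1
  have : (-(L / n : ℤ) + 2 * (L / n : ℤ)) * n = (L / n : ℤ) * n := by ring
  rw [this, neg_mul] at hs
  omega

theorem IsMover.equivalent_shift {Γ : C.GaugeHom} {e : Cell} {n ρ : ℕ} {P : Cell →₀ M}
    (h : C.IsMover Γ e n ρ P) (i : ℤ) : C.Equivalent (shiftHom ((i * n : ℤ) • e) Γ) Γ := by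
  obtain ⟨m, rfl | rfl⟩ := i.eq_nat_or_neg
  · exact ⟨path P n e 0 m, by simp [h.twist_path]⟩
  · refine Equivalent.symm ⟨path P n e (-m) m, by simp [h.twist_path]⟩

theorem IsMover.localized_shift {Γ : C.GaugeHom} {e : Cell} {n ρ : ℕ} {P : Cell →₀ M}
    (h : C.IsMover Γ e n ρ P) (i : ℤ) :
    C.LocalizedIn (shiftHom ((i * n : ℤ) • e) Γ) (box ((i * n : ℤ) • e) ρ) := by
  simpa using h.localized.shiftHom ((i * n : ℤ) • e)

theorem IsAxes.box_subset {e f : Cell} (hef : IsAxes e f) {k k' : ℤ} {w w' : ℕ}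
    (h : k' - w' ≤ k - w) (h' : k + w ≤ k' + w') (hw : w ≤ w') :
    box (k • e) w ⊆ box (k' • e) w' := by
  intro s hs
  rw [hef.mem_box] at *
  omega

theorem IsMover.localized_head {Γ : C.GaugeHom} {e f : Cell} (hef : IsAxes e f) {n ρ : ℕ}
    {P : Cell →₀ M} (h : C.IsMover Γ e n ρ P) (L : ℕ) {w : ℕ} (hw : ρ + n ≤ w) :
    C.LocalizedIn (shiftHom (((L / n : ℕ) * n : ℤ) • e) Γ) (box ((L : ℤ) • e) w) := by
  have h1 := div_mul_bounds h.pos L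
  exact (h.localized_shift _).mono (IsAxes.box_subset hef (by omega) (by omega) (by omega))

theorem IsMover.localized_tail {Γ : C.GaugeHom} {e f : Cell} (hef : IsAxes e f) {n ρ : ℕ}
    {P : Cell →₀ M} (h : C.IsMover Γ e n ρ P) (L : ℕ) {w : ℕ} (hw : ρ + n ≤ w) :
    C.LocalizedIn (shiftHom ((-(L / n : ℕ) * n : ℤ) • e) Γ) (box ((-L : ℤ) • e) w) := by
  have h1 := div_mul_bounds h.pos L
  refine (h.localized_shift _).mono (IsAxes.box_subset hef ?_ ?_ (by omega)) <;>
  · rw [neg_mul]; omega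

theorem IsMover.isString {Γ : C.GaugeHom} {e f : Cell} (hef : IsAxes e f) {n ρ : ℕ}
    {P : Cell →₀ M} (h : C.IsMover Γ e n ρ P) (L : ℕ) {w : ℕ} (hw : ρ + n ≤ w) :
    C.IsString Γ e f L w (canonicalString P n e L) := by
  refine ⟨supportedIn_mono ?_ (h.canonicalString_mem hef L), _, _, h.equivalent_shift _,
    h.localized_head hef L hw, h.equivalent_shift _, h.localized_tail hef L hw,
    h.twist_canonicalString L⟩
  intro s hs
  rw [mem_strip] at *
  omega

theorem LocalizedIn.eq_zero {Γ : C.GaugeHom} {R R' : Set Cell} (h : C.LocalizedIn Γ R)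
    (hR : ∀ c ∈ R, c ∉ R') (g : C.gauge) (hg : (g : Cell →₀ M) ∈ C.gensIn R') : Γ g = 0 := by
  by_contra hne
  have h1 := h g hg.2.1 hne
  refine hne ?_
  have : g = 0 := by
    ext c
    by_contra hc
    exact hR c (h1 c hc) (hg.2.2 c hc)
  rw [this, map_zero]

theorem LocalizedIn.eq_zero_of_mem_closure {Γ : C.GaugeHom} {R R' : Set Cell}
    (h : C.LocalizedIn Γ R) (hR : ∀ c ∈ R, c ∉ R') (g : C.gauge)
    (hg : (g : Cell →₀ M) ∈ AddSubgroup.closure (C.gensIn R')) : Γ g = 0 :=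
  eq_zero_of_mem_closure_gensIn (h.eq_zero hR) g hg

theorem Equivalent.sub_zero {Γ Γ' : C.GaugeHom} (h : C.Equivalent Γ Γ') :
    C.Equivalent (Γ - Γ') 0 := by
  obtain ⟨P, hP⟩ := h
  exact ⟨P, by simpa using hP⟩

/-- The longer string is the shorter one with `j` more steps attached at each end. -/
theorem IsMover.canonicalString_sub_mem {Γ : C.GaugeHom} {e f : Cell} (hef : IsAxes e f)
    {n ρ : ℕ} {P : Cell →₀ M} (h : C.IsMover Γ e n ρ P) {L L' : ℕ} (hL : L ≤ L') :
    canonicalString P n e L' - canonicalString P n e L ∈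
      supportedIn M {s | (L : ℤ) ≤ |coord e s| + (n + ρ)} := by
  have hLn := div_mul_bounds h.pos L
  obtain ⟨j, hj⟩ := Nat.exists_eq_add_of_le (Nat.div_le_div_right (c := n) hL)
  set m := L / n
  have key : canonicalString P n e L' - canonicalString P n e L =
      path P n e (-m - j) j + path P n e m j := by
    rw [canonicalString, canonicalString, hj]
    have : 2 * (m + j) = j + 2 * m + j := by ring
    rw [this, path_add, path_add]
    have e1 : -((m + j : ℕ) : ℤ) = -m - j := by push_cast; ring
    have e2 : -(m : ℤ) - j + j = -m := by ring
    have e3 : -(m : ℤ) - j + (j + 2 * m : ℕ) = m := by push_cast; ring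
    rw [e1, e2, e3]
    abel
  rw [key]
  refine add_mem ?_ ?_
  · refine supportedIn_mono (fun s hs => ?_) (h.path_mem hef _ _)
    have := neg_le_abs (coord e s)
    simp only [Set.mem_ofPred_eq, sub_add_cancel, neg_mul] at *
    omega
  · refine supportedIn_mono (fun s hs => ?_) (h.path_mem hef _ _)
    have := le_abs_self (coord e s)
    simp only [Set.mem_ofPred_eq] at *
    omega

variable [Finite M]

/-- The ends of a string operator can be moved arbitrarily far away, changing the operator only
near and beyond its ends. -/
theorem IsMover.exists_escape {Γ : C.GaugeHom} {e f : Cell} (hef : IsAxes e f) {n ρ : ℕ}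
    {P : Cell →₀ M} (h : C.IsMover Γ e n ρ P) (w : ℕ) :
    ∃ c : ℕ, ∀ L W, C.IsString Γ e f L w W → ∀ D : ℕ, ∃ W',
      W' - W ∈ supportedIn M {s | (L : ℤ) ≤ |coord e s| + c} ∧
      ∀ g ∈ AddSubgroup.closure (C.gensIn (box 0 D)), C.σ W' g = 0 := by
  obtain ⟨R, hR⟩ := C.exists_radius_trivial (w + (ρ + n))
  -- This radius must not involve `D`, which will be chosen depending on the strings under
  -- comparison.
  refine ⟨R + n + ρ, ?_⟩
  rintro L W ⟨-, Γh, Γt, hh, hhl, ht, htl, hW⟩ D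
  have hL := div_mul_bounds h.pos L
  set m : ℕ := L / n with hm
  -- As `n ≥ 1`, this many further steps carry a twist of radius `ρ` out of the box of radius `D`.
  set N : ℕ := D + ρ + 1
  have hN : (N : ℤ) ≤ N * n := by
    have := h.pos
    exact_mod_cast Nat.le_mul_of_pos_right N this
  have hNe : (N : ℤ) = D + ρ + 1 := by simp [N]
  -- `Ph` and `Pt` exchange the given end twists for translates of `Γ`, from which the paths of the
  -- mover can continue.
  obtain ⟨Ph, hPh, hPh'⟩ := hR ((L : ℤ) • e) (Γh - shiftHom ((m * n : ℤ) • e) Γ)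
    ((hhl.mono (box_mono (by omega))).sub (h.localized_head hef L (by omega)))
    (hh.trans (h.equivalent_shift _).symm).sub_zero
  obtain ⟨Pt, hPt, hPt'⟩ := hR ((-L : ℤ) • e) (Γt - shiftHom ((-m * n : ℤ) • e) Γ)
    ((htl.mono (box_mono (by omega))).sub (h.localized_tail hef L (by omega)))
    (ht.trans (h.equivalent_shift _).symm).sub_zero
  refine ⟨W + (Pt - Ph + path P n e m N + path P n e (-m - N) N), ?_, ?_⟩
  · rw [add_sub_cancel_left]
    refine add_mem (add_mem (sub_mem ?_ ?_) ?_) ?_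
    · refine supportedIn_mono (fun s hs => ?_) hPt
      rw [hef.mem_box] at hs
      have := neg_le_abs (coord e s)
      simp only [Set.mem_ofPred_eq]
      push_cast
      omega
    · refine supportedIn_mono (fun s hs => ?_) hPh
      rw [hef.mem_box] at hs
      have := le_abs_self (coord e s)
      simp only [Set.mem_ofPred_eq]
      push_cast
      omega
    · refine supportedIn_mono (fun s hs => ?_) (h.path_mem hef _ _)
      have := le_abs_self (coord e s)
      simp only [Set.mem_ofPred_eq] at *
      push_cast
      omega
    · refine supportedIn_mono (fun s hs => ?_) (h.path_mem hef _ _)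
      have := neg_le_abs (coord e s)
      simp only [Set.mem_ofPred_eq, sub_add_cancel, neg_mul] at *
      push_cast
      omega
  · intro g hg
    have hgg : g ∈ C.gauge := by
      refine (AddSubgroup.closure_le _).2 ?_ hg
      exact fun x hx => hx.1
    have key : C.twist (W + (Pt - Ph + path P n e m N + path P n e (-m - N) N)) =
        shiftHom (((m + N) * n : ℤ) • e) Γ - shiftHom (((-m - N) * n : ℤ) • e) Γ := by
      simp only [map_add, map_sub, hW, hPt', hPh', h.twist_path, sub_add_cancel]
      abel
    have hmn : 0 ≤ (m * n : ℤ) := by positivity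
    have e1 : shiftHom (((m + N) * n : ℤ) • e) Γ ⟨g, hgg⟩ = 0 := by
      refine (h.localized_shift _).eq_zero_of_mem_closure (fun c hc hc' => ?_) ⟨g, hgg⟩ hg
      rw [hef.mem_box, add_mul] at hc
      rw [hef.mem_box_zero] at hc'
      omega
    have e2 : shiftHom (((-m - N) * n : ℤ) • e) Γ ⟨g, hgg⟩ = 0 := by
      refine (h.localized_shift _).eq_zero_of_mem_closure (fun c hc hc' => ?_) ⟨g, hgg⟩ hg
      rw [hef.mem_box, sub_mul, neg_mul] at hc
      rw [hef.mem_box_zero] at hc'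
      omega
    have := DFunLike.congr_fun key ⟨g, hgg⟩
    rw [twist_apply, AddMonoidHom.sub_apply, e1, e2, sub_zero] at this
    exact this

/-- The commutation phase of crossing string operators does not depend on the choice of one of
them. -/
theorem IsMover.form_eq_of_isString {Γ Γ' : C.GaugeHom} {e f : Cell} (hef : IsAxes e f)
    {n ρ : ℕ} {P : Cell →₀ M} (h : C.IsMover Γ' f n ρ P) (w : ℕ) :
    ∃ L₀ : ℕ, ∀ L ≥ L₀, ∀ W₁ W₂ W', C.IsString Γ e f L w W₁ → C.IsString Γ e f L w W₂ →
      C.IsString Γ' f e L w W' → C.σ W' W₁ = C.σ W' W₂ := by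
  obtain ⟨c, hc⟩ := h.exists_escape hef.symm w
  obtain ⟨R, hR⟩ := C.exists_radius_trivial w
  refine ⟨c + w + R + 1, ?_⟩
  rintro L hL W₁ W₂ W' ⟨hs₁, Γh₁, Γt₁, hh₁, hhl₁, ht₁, htl₁, hW₁⟩
    ⟨hs₂, Γh₂, Γt₂, hh₂, hhl₂, ht₂, htl₂, hW₂⟩ hW'
  obtain ⟨Ph, hPh, hPh'⟩ := hR _ _ (hhl₁.sub hhl₂) (hh₁.trans hh₂.symm).sub_zero
  obtain ⟨Pt, hPt, hPt'⟩ := hR _ _ (htl₁.sub htl₂) (ht₁.trans ht₂.symm).sub_zero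
  -- The difference of the strings with its ends repaired: it violates nothing, hence is a
  -- stabilizer and a product of gauge generators in some box of radius `D`. Pushing the ends of
  -- `W'` beyond that box gives an operator commuting with `K`, and the change happens away from
  -- `K`.
  set K := W₁ - W₂ - Ph + Pt with hK
  have hK0 : C.twist K = 0 := by
    simp only [hK, map_add, map_sub, hW₁, hW₂, hPh', hPt']
    abel
  obtain ⟨D, hD⟩ := exists_mem_closure_gensIn (C.stab_le_gauge (mem_stab_of_twist_eq_zero hK0))
  obtain ⟨W'', hsub, hz⟩ := hc L W' hW' D
  have hKs : K ∈ supportedIn M {s | |coord f s| ≤ w + R} := by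
    refine add_mem (sub_mem (sub_mem ?_ ?_) ?_) ?_
    · refine supportedIn_mono (fun s hs => ?_) hs₁
      rw [mem_strip] at hs
      simp only [Set.mem_ofPred_eq, abs_le]
      omega
    · refine supportedIn_mono (fun s hs => ?_) hs₂
      rw [mem_strip] at hs
      simp only [Set.mem_ofPred_eq, abs_le]
      omega
    · refine supportedIn_mono (fun s hs => ?_) hPh
      rw [hef.mem_box] at hs
      simp only [Set.mem_ofPred_eq, abs_le]
      omega
    · refine supportedIn_mono (fun s hs => ?_) hPt
      rw [hef.mem_box] at hs
      simp only [Set.mem_ofPred_eq, abs_le]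
      omega
  have h1 : C.σ (W'' - W') K = 0 := by
    refine form_eq_zero_of_disjoint _ hsub hKs fun s hs hs' => ?_
    simp only [Set.mem_ofPred_eq] at hs hs'
    omega
  have h2 : C.σ W' K = 0 := by
    rw [map_sub, AddMonoidHom.sub_apply, hz K hD, zero_sub, neg_eq_zero] at h1
    exact h1
  have h3 : C.σ W' Ph = 0 := by
    refine form_eq_zero_of_disjoint _ hW'.1 hPh fun s hs hs' => ?_
    rw [mem_strip] at hs
    rw [hef.mem_box] at hs'
    omega
  have h4 : C.σ W' Pt = 0 := by
    refine form_eq_zero_of_disjoint _ hW'.1 hPt fun s hs hs' => ?_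
    rw [mem_strip] at hs
    rw [hef.mem_box] at hs'
    omega
  rw [hK, map_add, map_sub, map_sub, h3, h4, sub_zero, add_zero, sub_eq_zero] at h2
  exact h2

/-- Every pair of anyon types has a braiding phase. -/
theorem exists_braiding [Finite C.Anyon] {Γ Γ' : C.GaugeHom} (hΓ : Γ ∈ C.twists)
    (hΓ' : Γ' ∈ C.twists) {e f : Cell} (hef : IsAxes e f) :
    ∃ (β : Additive Circle) (w₀ : ℕ), ∀ w ≥ w₀, ∃ L₀ : ℕ, ∀ L ≥ L₀,
      (∃ W, C.IsString Γ e f L w W) ∧ (∃ W', C.IsString Γ' f e L w W') ∧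
      ∀ W W', C.IsString Γ e f L w W → C.IsString Γ' f e L w W' → C.σ W' W = β := by
  obtain ⟨n, ρ, P, h⟩ := exists_isMover hΓ e
  obtain ⟨n', ρ', P', h'⟩ := exists_isMover hΓ' f
  set L₁ : ℕ := n + ρ + n' + ρ' + 1 with hL₁
  refine ⟨C.σ (canonicalString P' n' f L₁) (canonicalString P n e L₁), n + ρ + n' + ρ',
    fun w hw => ?_⟩
  obtain ⟨L₂, hL₂⟩ := h'.form_eq_of_isString (Γ := Γ) hef w
  obtain ⟨L₃, hL₃⟩ := h.form_eq_of_isString (Γ := Γ') hef.symm w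
  refine ⟨L₁ + L₂ + L₃, fun L hL => ?_⟩
  have hc := h.isString hef L (w := w) (by omega)
  have hc' := h'.isString hef.symm L (w := w) (by omega)
  refine ⟨⟨_, hc⟩, ⟨_, hc'⟩, fun W W' hW hW' => ?_⟩
  rw [hL₂ L (by omega) W _ W' hW hc hW', σ_antisymm, hL₃ L (by omega) W' _ _ hW' hc' hc,
    ← σ_antisymm]
  -- From length `L₁` on, the pieces added to either canonical string lie outside the strip of the
  -- other one, so the phase has stabilized.
  have e1 : C.σ (canonicalString P' n' f L)
      (canonicalString P n e L - canonicalString P n e L₁) = 0 := by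
    refine form_eq_zero_of_disjoint _ (h'.canonicalString_mem hef.symm L)
      (h.canonicalString_sub_mem hef (by omega)) fun s hs hs' => ?_
    rw [strip, Set.mem_ofPred_eq] at hs
    rw [Set.mem_ofPred_eq] at hs'
    omega
  have e2 : C.σ (canonicalString P' n' f L - canonicalString P' n' f L₁)
      (canonicalString P n e L₁) = 0 := by
    refine form_eq_zero_of_disjoint _ (h'.canonicalString_sub_mem hef.symm (by omega))
      (h.canonicalString_mem hef L₁) fun s hs hs' => ?_
    rw [strip, Set.mem_ofPred_eq] at hs'
    rw [Set.mem_ofPred_eq] at hs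
    omega
  rw [map_sub, sub_eq_zero] at e1
  rw [map_sub, AddMonoidHom.sub_apply, sub_eq_zero] at e2
  rw [e1, e2]

end LatticeCode

end TopSubsystem

/-! ### Extension of characters, and stabilizers on annuli. -/

namespace TopSubsystem

/-- Characters of a subgroup extend to the whole group. -/
theorem exists_extension {A : Type} [AddCommGroup A] (H : AddSubgroup A)
    (χ : H →+ Additive Circle) : ∃ χ' : A →+ Additive Circle, ∀ h : H, χ' h = χ h := by
  -- The circle is a quotient of `ℝ`, hence divisible, and divisible groups are injective.
  have hsurj : Function.Surjective Circle.expHom := by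
    intro z
    obtain ⟨x, hx⟩ := Circle.exp_surjective z.toMul
    exact ⟨x, congrArg Additive.ofMul hx⟩
  let _ : DivisibleBy (Additive Circle) ℤ :=
    hsurj.divisibleBy Circle.expHom fun a n => map_zsmul Circle.expHom n a
  obtain ⟨χ', h⟩ := (Module.Baer.of_divisible (Additive Circle)).extension_property_addMonoidHom
    H.subtype H.subtype_injective χ
  exact ⟨χ', fun x => DFunLike.congr_fun h x⟩

theorem exists_factorization {A B : Type} [AddCommGroup A] [AddCommGroup B] (f : B →+ A)
    (χ : B →+ Additive Circle) (h : f.ker ≤ χ.ker) :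
    ∃ χ' : A →+ Additive Circle, χ'.comp f = χ := by
  obtain ⟨χ', hχ'⟩ := exists_extension f.range
    (f.rangeRestrict.liftOfSurjective f.rangeRestrict_surjective
      ⟨χ, by rwa [AddMonoidHom.ker_rangeRestrict]⟩)
  refine ⟨χ', ?_⟩
  ext1 b
  have h1 := hχ' (f.rangeRestrict b)
  have h2 := AddMonoidHom.liftOfRightInverse_comp_apply f.rangeRestrict _
    (Function.rightInverse_surjInv f.rangeRestrict_surjective)
    ⟨χ, by rwa [AddMonoidHom.ker_rangeRestrict]⟩ b
  exact h1.trans h2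

namespace LatticeCode

variable {M : Type} [AddCommGroup M] {C : LatticeCode M}

/-- A character of the stabilizer group which is trivial on the stabilizers vanishing on a finite
region comes from a Pauli operator. -/
theorem exists_form_eq {R : Set Cell} (hR : R.Finite) (χ : C.stab →+ Additive Circle)
    (h : ∀ s : C.stab, (∀ c ∈ R, (s : Cell →₀ M) c = 0) → χ s = 0) :
    ∃ P, ∀ s : C.stab, C.σ P s = χ s := by
  classical
  let T := hR.toFinset
  let f : C.stab →+ (T → M) :=
    { toFun := fun s c => (s : Cell →₀ M) c
      map_zero' := rfl
      map_add' := fun _ _ => rfl }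
  -- `χ` only sees the restriction to `R`, so it extends to all configurations on `R`; there the
  -- perfect local form represents it cell by cell.
  obtain ⟨χ', hχ'⟩ := exists_factorization f χ fun s hs =>
    h s fun c hc => congrFun hs ⟨c, hR.mem_toFinset.2 hc⟩
  have key : ∀ c : T, ∃ m, ∀ x, C.local_form m x = χ' (Pi.single c x) := fun c =>
    C.exists_local_form_eq (χ'.comp (AddMonoidHom.single (fun _ : T => M) c))
  choose m hm using key
  refine ⟨∑ c : T, Finsupp.single (c : Cell) (m c), fun s => ?_⟩
  rw [map_sum, AddMonoidHom.finsetSum_apply, ← hχ', AddMonoidHom.comp_apply,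
    ← Finset.univ_sum_single (f s), map_sum]
  refine Finset.sum_congr rfl fun c _ => ?_
  rw [form_single, hm]
  rfl

/-- The small stabilizers supported in `R`. -/
def stabsIn (C : LatticeCode M) (R : Set Cell) : Set (Cell →₀ M) :=
  {s | s ∈ C.stab ∧ IsSmall C.sizeS s ∧ s ∈ supportedIn M R}

theorem closure_stabsIn_le (R : Set Cell) : AddSubgroup.closure (C.stabsIn R) ≤ C.stab :=
  (AddSubgroup.closure_le _).2 fun _ hx => hx.1

theorem eq_zero_of_mem_closure_stabsIn {Γ : C.GaugeHom} {R : Set Cell}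
    (h : ∀ g : C.gauge, (g : Cell →₀ M) ∈ C.stabsIn R → Γ g = 0) (g : C.gauge)
    (hg : (g : Cell →₀ M) ∈ AddSubgroup.closure (C.stabsIn R)) : Γ g = 0 := by
  have : AddSubgroup.closure (C.stabsIn R) ≤ Γ.ker.map C.gauge.subtype := by
    rw [AddSubgroup.closure_le]
    intro x hx
    exact ⟨⟨x, C.stab_le_gauge hx.1⟩, h _ hx, rfl⟩
  obtain ⟨g', h1, h2⟩ := this hg
  rw [← Subtype.ext (a1 := g') (a2 := g) h2]
  exact h1

variable [Finite M]

variable (C) in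
/-- Gauge twists are trivial on bounded gauge operators which are far away. -/
theorem exists_radius_far (m : ℕ) :
    ∃ c : ℕ, ∀ Γ p w, C.LocalizedIn Γ (box p w) → ∀ g : C.gauge, IsSmall m (g : Cell →₀ M) →
      ∀ c₀, (g : Cell →₀ M) c₀ ≠ 0 → c₀ ∉ box p (w + c) → Γ g = 0 := by
  -- Localization only speaks of operators of size `sizeG`; an operator of size `m` has to be
  -- factored into such generators nearby.
  obtain ⟨c, hc⟩ := C.exists_radius_closure_gensIn m
  refine ⟨c + m, fun Γ p w hΓ g hg c₀ h₀ hfar => ?_⟩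
  obtain ⟨q, hq⟩ := hg.exists_box
  refine hΓ.eq_zero_of_mem_closure (fun s hs hs' => hfar ?_) g (hc q g g.2 hq)
  have h1 := hq c₀ h₀
  rw [mem_box] at *
  push_cast
  omega

/-- If `Γ` acts on stabilizers unlike any Pauli operator, it violates stabilizers supported on
arbitrarily large annuli of constant width. -/
theorem exists_annulus {Γ : C.GaugeHom} (hΓ : Γ ∈ C.twists)
    (h : ¬ ∃ P, ∀ g : C.gauge, (g : Cell →₀ M) ∈ C.stab → C.σ P g = Γ g) :
    ∃ r₀ : ℕ, ∀ r ≥ r₀, ∃ g : C.gauge,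
      (g : Cell →₀ M) ∈ AddSubgroup.closure (C.stabsIn (box 0 r)) ∧
      (∀ c k, (g : Cell →₀ M) c ≠ 0 → k + C.sizeS ≤ r → c ∉ box 0 k) ∧ Γ g ≠ 0 := by
  obtain ⟨w, hw⟩ := hΓ
  obtain ⟨d, hd⟩ := C.exists_radius_far C.sizeS
  refine ⟨w + d, fun r hr => ?_⟩
  -- Otherwise `Γ` would factor through the restriction of stabilizers to the box, and a Pauli
  -- operator would act like it.
  have h1 : ∃ s : C.stab, (∀ c ∈ box 0 r, (s : Cell →₀ M) c = 0) ∧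
      Γ (AddSubgroup.inclusion C.stab_le_gauge s) ≠ 0 := by
    by_contra! hcon
    obtain ⟨P, hP⟩ := exists_form_eq (finite_box 0 r)
      (Γ.comp (AddSubgroup.inclusion C.stab_le_gauge)) hcon
    exact h ⟨P, fun g hg => hP ⟨g, hg⟩⟩
  obtain ⟨⟨s, hs⟩, hsz, hsΓ⟩ := h1
  have hs' := hs
  rw [← C.stab_local] at hs'
  -- Write `s = y + z` with `y` made of small stabilizers inside the box and `z` of those sticking
  -- out. `Γ` is trivial on `z`, so `Γ y ≠ 0`. Deep inside the box both `s` and `z` vanish, so `y`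
  -- does too: it lives on an annulus.
  have hsplit : {s | s ∈ C.stab ∧ IsSmall C.sizeS s} ⊆ C.stabsIn (box 0 r) ∪
      {s | s ∈ C.stab ∧ IsSmall C.sizeS s ∧ s ∉ supportedIn M (box 0 r)} := by
    intro x hx
    by_cases hxr : x ∈ supportedIn M (box 0 r)
    · exact Or.inl ⟨hx.1, hx.2, hxr⟩
    · exact Or.inr ⟨hx.1, hx.2, hxr⟩
  have hmem := AddSubgroup.closure_mono hsplit hs'
  rw [AddSubgroup.closure_union, AddSubgroup.mem_sup] at hmem
  obtain ⟨y, hy, z, hz, hyz⟩ := hmem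
  have hout : ∀ x, x ∈ C.stab ∧ IsSmall C.sizeS x ∧ x ∉ supportedIn M (box 0 r) →
      ∃ c₀, x c₀ ≠ 0 ∧ c₀ ∉ box 0 r := by
    intro x hx
    simpa [mem_supportedIn] using hx.2.2
  have hzs : z ∈ C.stab ∧ (∀ c k, k + C.sizeS ≤ r → c ∈ box 0 k → z c = 0) ∧
      ∃ hzg : z ∈ C.gauge, Γ ⟨z, hzg⟩ = 0 := by
    clear hyz
    induction hz using AddSubgroup.closure_induction with
    | mem x hx =>
      obtain ⟨c₀, h₀, h₀'⟩ := hout x hx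
      refine ⟨hx.1, fun c k hk hc => ?_, C.stab_le_gauge hx.1, ?_⟩
      · by_contra hne
        have := hx.2.1.dist_le hne h₀
        refine h₀' ?_
        rw [mem_box] at *
        omega
      · exact hd Γ 0 w hw _ hx.2.1 c₀ h₀ fun hc => h₀' (box_mono hr hc)
    | zero => exact ⟨zero_mem _, fun _ _ _ _ => rfl, zero_mem _, map_zero Γ⟩
    | add x x' _ _ hx hx' =>
      obtain ⟨a1, a2, a3, a4⟩ := hx
      obtain ⟨b1, b2, b3, b4⟩ := hx'
      refine ⟨add_mem a1 b1, fun c k hk hc => ?_, add_mem a3 b3, ?_⟩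
      · simp [a2 c k hk hc, b2 c k hk hc]
      · have := map_add Γ ⟨x, a3⟩ ⟨x', b3⟩
        rw [a4, b4, add_zero] at this
        exact this
    | neg x _ hx =>
      obtain ⟨a1, a2, a3, a4⟩ := hx
      refine ⟨neg_mem a1, fun c k hk hc => ?_, neg_mem a3, ?_⟩
      · simp [a2 c k hk hc]
      · have := map_neg Γ ⟨x, a3⟩
        rw [a4, neg_zero] at this
        exact this
  obtain ⟨hz1, hz2, hzg, hz3⟩ := hzs
  have hyg : y ∈ C.gauge := C.stab_le_gauge (closure_stabsIn_le _ hy)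
  refine ⟨⟨y, hyg⟩, hy, fun c k hne hk hc => hne ?_, fun h0 => hsΓ ?_⟩
  · have h1 := hsz c (box_mono (by omega) hc)
    have h2 := hz2 c k hk hc
    have h3 := DFunLike.congr_fun hyz c
    simpa [h1, h2] using h3
  · have h1 := map_add Γ ⟨y, hyg⟩ ⟨z, hzg⟩
    rw [h0, hz3, add_zero] at h1
    rw [← h1]
    congr 1
    exact Subtype.ext hyz.symm

end LatticeCode

end TopSubsystem

/-! ### Finite generation of the relations of a translation-covariant family. -/

namespace TopSubsystem

section Relations

variable {F : Type} [Fintype F] {A : Type} [AddCommGroup A]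

/-- Integer combinations of pairs of a lattice vector and an index. -/
abbrev Combination (F : Type) : Type := F → AddMonoidAlgebra ℤ Cell

/-- Evaluation of integer combinations in an abelian group. -/
def evalCombination (φ : Cell → F → A) : Combination F →+ A :=
  ∑ f, (((Finsupp.liftAddHom fun t => (zmultiplesHom A (φ t f))).comp
    AddMonoidAlgebra.coeffAddEquiv.toAddMonoidHom).comp
      (Pi.evalAddMonoidHom (fun _ => AddMonoidAlgebra ℤ Cell) f))

theorem evalCombination_apply (φ : Cell → F → A) (x : Combination F) :
    evalCombination φ x = ∑ f, (x f).coeff.sum fun t n => n • φ t f := by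
  rw [evalCombination, AddMonoidHom.finsetSum_apply]
  rfl

/-- Monomials act by translating the family, so for a covariant family the relations form a module
over `ℤ[ℤ²]`. -/
theorem evalCombination_single_smul (φ : Cell → F → A) (t : Cell)
    (x : Combination F) :
    evalCombination φ (AddMonoidAlgebra.single t (1 : ℤ) • x) =
      evalCombination (fun s => φ (t + s)) x := by
  rw [evalCombination_apply, evalCombination_apply]
  refine Finset.sum_congr rfl fun f _ => ?_
  rw [Pi.smul_apply, smul_eq_mul]
  induction x f using AddMonoidAlgebra.induction_linear with
  | zero => simp
  | add y z hy hz =>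
    rw [mul_add, AddMonoidAlgebra.coeff_add, AddMonoidAlgebra.coeff_add,
      Finsupp.sum_add_index' (by simp) (by intros; rw [add_smul]),
      Finsupp.sum_add_index' (by simp) (by intros; rw [add_smul]), hy, hz]
  | single s n =>
    rw [AddMonoidAlgebra.single_mul_single, AddMonoidAlgebra.coeff_single,
      AddMonoidAlgebra.coeff_single, Finsupp.sum_single_index (by simp),
      Finsupp.sum_single_index (by simp), one_mul]

theorem evalCombination_congr {φ ψ : Cell → F → A} {x : Combination F}
    (h : ∀ f, ∀ t, (x f).coeff t ≠ 0 → φ t f = ψ t f) :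
    evalCombination φ x = evalCombination ψ x := by
  rw [evalCombination_apply, evalCombination_apply]
  refine Finset.sum_congr rfl fun f _ => Finset.sum_congr rfl fun t ht => ?_
  simp only [h f t (Finsupp.mem_support_iff.1 ht)]

theorem map_evalCombination {B : Type} [AddCommGroup B] (g : A →+ B)
    (φ : Cell → F → A) (x : Combination F) :
    g (evalCombination φ x) = evalCombination (fun t f => g (φ t f)) x := by
  rw [evalCombination_apply, evalCombination_apply, map_sum]
  refine Finset.sum_congr rfl fun f _ => ?_
  rw [map_finsuppSum]
  refine Finset.sum_congr rfl fun t _ => ?_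
  exact map_zsmul _ _ _

/-- The relations of a translation-covariant family are generated by relations of bounded size:
there is a radius `ρ` such that a family of values satisfies all relations of `φ` as soon as it
satisfies the relations within each ball of radius `ρ`. -/
theorem exists_relation_radius (φ : Cell → F → A)
    (hφ : ∀ (t : Cell) (x : Combination F), evalCombination φ x = 0 →
      evalCombination φ (AddMonoidAlgebra.single t (1 : ℤ) • x) = 0) :
    ∃ ρ : ℕ, ∀ ψ : Cell → F → Additive Circle,
      (∀ t, ∃ χ : A →+ Additive Circle, ∀ s ∈ box t ρ, ∀ f, ψ s f = χ (φ s f)) →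
      ∀ x, evalCombination φ x = 0 → evalCombination ψ x = 0 := by
  -- Hilbert's basis theorem: the module of relations is finitely generated, and `ρ` bounds the
  -- supports of the generators.
  have : IsNoetherianRing (AddMonoidAlgebra ℤ Cell) :=
    Algebra.FiniteType.isNoetherianRing ℤ _
  have hker : ∀ (a : AddMonoidAlgebra ℤ Cell) x, evalCombination φ x = 0 →
      evalCombination φ (a • x) = 0 := by
    intro a x hx
    induction a using AddMonoidAlgebra.induction_linear with
    | zero => simp
    | add y z hy hz => rw [add_smul, map_add, hy, hz, add_zero]
    | single t n =>
      have : AddMonoidAlgebra.single t n = n • AddMonoidAlgebra.single t (1 : ℤ) := by simp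
      rw [this, smul_assoc, map_zsmul, hφ t x hx, smul_zero]
  let N : Submodule (AddMonoidAlgebra ℤ Cell) (Combination F) :=
    { carrier := {x | evalCombination φ x = 0}
      zero_mem' := map_zero _
      add_mem' := fun {x y} hx hy => by
        change evalCombination φ (x + y) = 0
        rw [map_add, show evalCombination φ x = 0 from hx, show evalCombination φ y = 0 from hy,
          add_zero]
      smul_mem' := fun a x hx => hker a x hx }
  obtain ⟨K, hK⟩ := IsNoetherian.noetherian N
  obtain ⟨ρ, hρ⟩ : ∃ ρ : ℕ, ∀ k ∈ K, ∀ f t, (k f).coeff t ≠ 0 → t ∈ box 0 ρ := by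
    have h1 : ∀ kf : K × F, ∃ r : ℕ, ∀ t, (kf.1.1 kf.2).coeff t ≠ 0 → t ∈ box 0 r :=
      fun kf => exists_mem_supportedIn_box _
    choose r hr using h1
    obtain ⟨ρ, hρ⟩ := (Set.finite_range r).bddAbove
    exact ⟨ρ, fun k hk f t ht => box_mono (hρ ⟨(⟨k, hk⟩, f), rfl⟩) (hr (⟨k, hk⟩, f) t ht)⟩
  refine ⟨ρ, fun ψ hψ x hx => ?_⟩
  have hx' : x ∈ N := hx
  rw [← hK] at hx'
  have hgen : ∀ (a : AddMonoidAlgebra ℤ Cell), ∀ k ∈ K, evalCombination ψ (a • k) = 0 := by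
    intro a k hk
    induction a using AddMonoidAlgebra.induction_linear with
    | zero => simp
    | add y z hy hz => rw [add_smul, map_add, hy, hz, add_zero]
    | single t n =>
      have : AddMonoidAlgebra.single t n = n • AddMonoidAlgebra.single t (1 : ℤ) := by simp
      rw [this, smul_assoc, map_zsmul, evalCombination_single_smul]
      obtain ⟨χ, hχ⟩ := hψ t
      have hkN : evalCombination φ k = 0 := by
        have : k ∈ N := hK ▸ Submodule.subset_span hk
        exact this
      have h0 := congrArg χ (hφ t k hkN)
      rw [evalCombination_single_smul, map_evalCombination, map_zero] at h0
      rw [evalCombination_congr (ψ := fun s f => χ (φ (t + s) f)), h0, smul_zero]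
      intro f s hs
      refine hχ _ ?_ f
      have := hρ k hk f s hs
      rw [mem_box] at *
      simp only [Prod.fst_zero, Prod.snd_zero, Prod.fst_add, Prod.snd_add] at *
      omega
  -- `ψ` is not covariant, so its relations need not form a submodule; proving the claim for all
  -- multiples of `x` makes the induction over the span work.
  suffices h : ∀ a : AddMonoidAlgebra ℤ Cell, evalCombination ψ (a • x) = 0 by
    simpa using h 1
  clear hx
  induction hx' using Submodule.span_induction with
  | mem x h => exact fun a => hgen a x h
  | zero => simp
  | add x y _ _ hx hy => intro a; rw [smul_add, map_add, hx, hy, add_zero]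
  | smul b x _ hx => intro a; rw [smul_smul]; exact hx _

end Relations

end TopSubsystem

/-! ### Splitting of twists, and nontrivial braiding from annuli. -/

namespace TopSubsystem
namespace LatticeCode

variable {M : Type} [AddCommGroup M] [Finite M] (C : LatticeCode M)

/-- Gauge twists violating gauge generators in two distant regions only are products of gauge
twists localized in these regions. -/
theorem exists_splitting : ∃ K : ℕ, ∀ (Γ : C.GaugeHom) (A B : Set Cell),
    (∀ g : C.gauge, IsSmall C.sizeG (g : Cell →₀ M) → Γ g ≠ 0 →
      (g : Cell →₀ M) ∈ supportedIn M A ∨ (g : Cell →₀ M) ∈ supportedIn M B) →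
    (∀ c ∈ A, ∀ c' ∈ B, c' ∉ box c K) →
    ∃ Γ₁ Γ₂, C.LocalizedIn Γ₁ A ∧ C.LocalizedIn Γ₂ B ∧ Γ = Γ₁ + Γ₂ := by
  classical
  -- Finitely many generators whose translates exhaust the small gauge operators.
  let F : Type := {g : C.gauge // IsSmall C.sizeG (g : Cell →₀ M) ∧
    (g : Cell →₀ M) ∈ supportedIn M (box 0 C.sizeG)}
  have hF : Finite F := by
    have := finite_supportedIn (M := M) (finite_box 0 C.sizeG)
    refine Finite.of_injective
      (fun g : F => (⟨g.1.1, g.2.2⟩ : supportedIn M (box 0 C.sizeG))) fun g g' h => ?_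
    simp only [Subtype.mk.injEq] at h
    exact Subtype.ext (Subtype.ext h)
  have := Fintype.ofFinite F
  let φ : Cell → F → C.gauge := fun t g => gaugeShift t g.1
  have hsmall : ∀ t f, IsSmall C.sizeG (φ t f : Cell →₀ M) := fun t f => f.2.1.shift t
  have hbox : ∀ t f, (φ t f : Cell →₀ M) ∈ supportedIn M (box t C.sizeG) := fun t f => by
    have := shift_mem_box (t := t) f.2.2
    rwa [zero_add] at this
  have hφshift : ∀ t s f, φ (t + s) f = gaugeShift t (φ s f) := fun t s f =>
    Subtype.ext (shift_shift _ _ _).symm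
  have hgen : ∀ g : C.gauge, IsSmall C.sizeG (g : Cell →₀ M) → ∃ t f, φ t f = g := by
    intro g hg
    obtain ⟨p, hp⟩ := hg.exists_box
    refine ⟨p, ⟨gaugeShift (-p) g, hg.shift _, by simpa using shift_mem_box (t := -p) hp⟩, ?_⟩
    exact Subtype.ext (by simp [φ, shift_shift])
  obtain ⟨ρ, hρ⟩ := exists_relation_radius φ (by
    intro t x hx
    rw [evalCombination_single_smul]
    have : (fun s => φ (t + s)) = fun s f => gaugeShift t (φ s f) :=
      funext fun s => funext fun f => hφshift t s f
    rw [this, ← map_evalCombination, hx, map_zero])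
  have hsurj : Function.Surjective (evalCombination φ) := by
    intro g
    have hle : AddSubgroup.closure {g | g ∈ C.gauge ∧ IsSmall C.sizeG g} ≤
        (evalCombination φ).range.map C.gauge.subtype := by
      rw [AddSubgroup.closure_le]
      rintro x ⟨hx, hxs⟩
      obtain ⟨t, f, htf⟩ := hgen ⟨x, hx⟩ hxs
      refine ⟨⟨x, hx⟩, ⟨Pi.single f (AddMonoidAlgebra.single t 1), ?_⟩, rfl⟩
      rw [evalCombination_apply, Finset.sum_eq_single f]
      · simp [htf]
      · intro b _ hb
        simp [Pi.single_eq_of_ne hb]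
      · simp
    rw [C.gauge_local] at hle
    obtain ⟨g', ⟨x, hx⟩, h2⟩ := hle g.2
    exact ⟨x, hx.trans (Subtype.ext h2)⟩
  -- The largest possible distance between cells of two generators whose base points lie in a common
  -- ball of radius `ρ`.
  refine ⟨2 * ρ + 2 * C.sizeG, fun Γ A B hΓ hAB => ?_⟩
  let ψ : Cell → F → Additive Circle := fun t f =>
    if (φ t f : Cell →₀ M) ∈ supportedIn M A then Γ (φ t f) else 0
  have hψ : ∀ x, evalCombination φ x = 0 → evalCombination ψ x = 0 := by
    refine hρ ψ fun t => ?_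
    -- No ball sees both regions: if a violation at `B` was switched off in it, then `ψ` vanishes
    -- throughout the ball; otherwise `ψ` agrees with `Γ` there. Either way it is locally a
    -- character.
    by_cases hex : ∃ s ∈ box t ρ, ∃ f, ψ s f ≠ Γ (φ s f)
    · refine ⟨0, fun s' hs' f' => ?_⟩
      by_contra hne
      obtain ⟨s, hs, f, hf⟩ := hex
      have hA : (φ s' f' : Cell →₀ M) ∈ supportedIn M A := by
        by_contra h
        exact hne (if_neg h)
      have hne' : Γ (φ s' f') ≠ 0 := by
        have : ψ s' f' = Γ (φ s' f') := if_pos hA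
        rw [← this]
        exact hne
      have hnA : ¬ (φ s f : Cell →₀ M) ∈ supportedIn M A := fun h => hf (if_pos h)
      have hf' : Γ (φ s f) ≠ 0 := fun h => hf ((if_neg hnA).trans h.symm)
      have hB := (hΓ _ (hsmall s f) hf').resolve_left hnA
      have hnz : ∀ g : C.gauge, Γ g ≠ 0 → ∃ c, (g : Cell →₀ M) c ≠ 0 := by
        intro g hg
        by_contra! hcon
        exact hg (by rw [show g = 0 from Subtype.ext (Finsupp.ext hcon), map_zero])
      obtain ⟨c, hc⟩ := hnz _ hf'
      obtain ⟨c', hc'⟩ := hnz _ hne'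
      have h1 := hbox s f c hc
      have h2 := hbox s' f' c' hc'
      refine hAB c' (hA c' hc') c (hB c hc) ?_
      rw [mem_box] at *
      push_cast
      omega
    · push Not at hex
      exact ⟨Γ, hex⟩
  let Γ₁ : C.GaugeHom := (evalCombination φ).liftOfSurjective hsurj ⟨evalCombination ψ, hψ⟩
  have hΓ₁ : ∀ t f, Γ₁ (φ t f) = ψ t f := by
    intro t f
    have heval : ∀ {A : Type} [AddCommGroup A] (χ : Cell → F → A),
        evalCombination χ (Pi.single f (AddMonoidAlgebra.single t 1)) = χ t f := by
      intro A _ χ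
      rw [evalCombination_apply, Finset.sum_eq_single f]
      · simp
      · intro b _ hb
        simp [Pi.single_eq_of_ne hb]
      · simp
    have := AddMonoidHom.liftOfRightInverse_comp_apply (evalCombination φ) _
      (Function.rightInverse_surjInv hsurj) ⟨evalCombination ψ, hψ⟩
      (Pi.single f (AddMonoidAlgebra.single t 1))
    rw [heval] at this
    exact this.trans (heval ψ)
  refine ⟨Γ₁, Γ - Γ₁, ?_, ?_, by abel⟩
  · intro g hg hne
    obtain ⟨t, f, rfl⟩ := hgen g hg
    rw [hΓ₁] at hne
    by_contra hcon
    exact hne (if_neg hcon)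
  · intro g hg hne
    obtain ⟨t, f, rfl⟩ := hgen g hg
    rw [AddMonoidHom.sub_apply, hΓ₁] at hne
    have hnA : ¬ (φ t f : Cell →₀ M) ∈ supportedIn M A := fun h => hne (by simp [ψ, h])
    refine (hΓ _ hg fun h0 => hne ?_).resolve_left hnA
    simp [ψ, hnA, h0]

variable {C}

theorem isAxes : IsAxes (1, 0) (0, 1) := Or.inl ⟨rfl, rfl⟩

/-- If `Γ` acts on stabilizers unlike any Pauli operator, arbitrarily long string operators of its
type have nontrivial commutation phase with string operators of some other type. -/
theorem exists_strings_form_ne_zero [Finite C.Anyon] {Γ : C.GaugeHom} (hΓ : Γ ∈ C.twists)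
    (h : ¬ ∃ P, ∀ g : C.gauge, (g : Cell →₀ M) ∈ C.stab → C.σ P g = Γ g) :
    ∃ w₀ : ℕ, ∀ w ≥ w₀, ∀ L₀ : ℕ, ∃ L ≥ L₀, ∃ Γ' ∈ C.twists, ∃ W W',
      C.IsString Γ (1, 0) (0, 1) L w W ∧ C.IsString Γ' (0, 1) (1, 0) L w W' ∧
      C.σ W' W ≠ 0 := by
  classical
  obtain ⟨n, ρ, P, hP⟩ := exists_isMover hΓ (1, 0)
  obtain ⟨r₀, hr₀⟩ := exists_annulus hΓ h
  obtain ⟨K, hK⟩ := C.exists_splitting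
  obtain ⟨d, hd⟩ := C.exists_radius_far C.sizeS
  set ℓ := C.sizeS + 1
  refine ⟨ρ + n + ℓ + C.sizeG, fun w hw L₀ => ?_⟩
  set m : ℕ := r₀ + L₀ + K + d + 2 * w + 1 with hm
  -- A multiple of `n`, so that the canonical string ends exactly at `± r`.
  set r : ℕ := m * n with hr
  have hrm : m ≤ r := Nat.le_mul_of_pos_right m hP.pos
  obtain ⟨g₀, hg₀, hann, hne⟩ := hr₀ r (by omega)
  -- The annulus is moved to the left by `r`: its center is now the tail of the horizontal string,
  -- and its right side runs along the vertical axis.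
  set g : C.gauge := gaugeShift (-(r : ℤ), 0) g₀ with hg
  have hgs : (g : Cell →₀ M) ∈ C.stab :=
    C.shift_mem_stab _ (closure_stabsIn_le _ hg₀)
  have hg₀box : (g₀ : Cell →₀ M) ∈ supportedIn M (box 0 r) :=
    (AddSubgroup.closure_le _).2 (fun x hx => hx.2.2) hg₀
  have hgsupp : ∀ c, (g : Cell →₀ M) c ≠ 0 →
      (-2 * r ≤ c.1 ∧ c.1 ≤ 0 ∧ -r ≤ c.2 ∧ c.2 ≤ r) ∧
      (c.1 < -2 * r + ℓ ∨ -ℓ < c.1 ∨ c.2 < -r + ℓ ∨ r - ℓ < c.2) := by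
    intro c hc
    have hc₀ : (g₀ : Cell →₀ M) (c - (-(r : ℤ), 0)) ≠ 0 := by
      simpa [hg] using hc
    have h1 := hg₀box _ hc₀
    have h2 := hann _ (r - C.sizeS) hc₀ (by omega)
    rw [mem_box] at h1 h2
    simp only [Prod.fst_sub, Prod.snd_sub, Prod.fst_zero, Prod.snd_zero] at h1 h2
    omega
  set W := canonicalString P n (1, 0) r with hW
  have hWs : C.IsString Γ (1, 0) (0, 1) r w W := hP.isString isAxes r (by omega)
  have hWsupp := hP.canonicalString_mem isAxes r
  -- The right side of the annulus, a candidate for the vertical string.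
  set W' : Cell →₀ M := (g : Cell →₀ M).filter fun c => -(ℓ : ℤ) ≤ c.1 with hW'
  have hpos : ∀ c : Cell, -(ℓ : ℤ) ≤ c.1 → W' c = (g : Cell →₀ M) c :=
    fun c => Finsupp.filter_apply_pos (fun c : Cell => -(ℓ : ℤ) ≤ c.1) _
  have hneg : ∀ c : Cell, ¬ -(ℓ : ℤ) ≤ c.1 → W' c = 0 :=
    fun c => Finsupp.filter_apply_neg (fun c : Cell => -(ℓ : ℤ) ≤ c.1) _
  -- `W` meets the annulus only in its right side, so `W'` can be replaced by `g`. Against `g`, the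
  -- head of `W` is too far away to contribute, and the tail at the center contributes `Γ g₀`.
  have hform : C.σ W' W = Γ g₀ := by
    have hsub : C.σ ((g : Cell →₀ M) - W') W = 0 := by
      refine form_eq_zero _ fun c h1 h2 => ?_
      have h3 : ¬ -(ℓ : ℤ) ≤ c.1 := fun hp => h1 (by
        rw [Finsupp.sub_apply, hpos _ hp, sub_self])
      have h4 : (g : Cell →₀ M) c ≠ 0 := by
        rwa [Finsupp.sub_apply, hneg _ h3, sub_zero] at h1
      have h5 := hgsupp c h4
      have h6 := hWsupp c h2
      rw [mem_strip] at h6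
      simp only [coord, one_mul, zero_mul, add_zero, zero_add] at h6
      omega
    rw [map_sub, AddMonoidHom.sub_apply, sub_eq_zero] at hsub
    rw [← hsub, σ_antisymm]
    have htw := DFunLike.congr_fun (hP.twist_canonicalString r) g
    rw [twist_apply, AddMonoidHom.sub_apply] at htw
    have hdiv : r / n = m := Nat.mul_div_cancel m hP.pos
    have hrz : (m * n : ℤ) = r := by rw [hr]; push_cast; rfl
    rw [hdiv, neg_mul, hrz] at htw
    have ht : shiftHom ((-(r : ℤ)) • (1, 0)) Γ g = Γ g₀ := by
      rw [shiftHom_apply]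
      congr 1
      refine Subtype.ext ?_
      simp only [hg, coe_gaugeShift, shift_shift]
      have e : -(-(r : ℤ) • ((1, 0) : Cell)) + (-(r : ℤ), 0) = 0 := by ext <;> simp
      rw [e, shift_zero]
    have hh : shiftHom ((r : ℤ) • (1, 0)) Γ g = 0 := by
      have e1 : shiftHom ((r : ℤ) • (1, 0)) Γ g = shiftHom ((2 * r : ℤ) • (1, 0)) Γ g₀ := by
        rw [shiftHom_apply, shiftHom_apply]
        congr 1
        refine Subtype.ext ?_
        simp only [hg, coe_gaugeShift, shift_shift]
        congr 2
        ext <;> simp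
        ring
      rw [e1]
      refine eq_zero_of_mem_closure_stabsIn (R := box 0 r) (fun x hx => ?_) g₀ hg₀
      by_cases hx0 : x = 0
      · rw [hx0, map_zero]
      · obtain ⟨c, hc⟩ : ∃ c, (x : Cell →₀ M) c ≠ 0 := by
          by_contra! hcon
          exact hx0 (Subtype.ext (Finsupp.ext hcon))
        refine hd _ _ _ (hP.localized.shiftHom _) x hx.2.1 c hc fun hbox => ?_
        have h1 := hx.2.2 c hc
        rw [mem_box] at h1 hbox
        simp only [Prod.fst_zero, Prod.snd_zero, Prod.fst_add, Prod.smul_fst, smul_eq_mul] at h1 hbox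
        push_cast at hbox
        omega
    rw [← hW] at htw
    rw [htw, ht, hh, zero_sub, neg_neg]
  -- The stabilizer `g` commutes with `x`, so a violated `x` must meet both `W'` and the rest of
  -- `g`. That happens only near the two corners where the annulus was cut.
  have hviol : ∀ x : C.gauge, IsSmall C.sizeG (x : Cell →₀ M) → C.twist W' x ≠ 0 →
      (x : Cell →₀ M) ∈ supportedIn M (box ((r : ℤ) • (0, 1)) w) ∨
      (x : Cell →₀ M) ∈ supportedIn M (box ((-r : ℤ) • (0, 1)) w) := by
    intro x hx hxne
    have h1 : ∃ c, W' c ≠ 0 ∧ (x : Cell →₀ M) c ≠ 0 := by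
      by_contra! hcon
      exact hxne (form_eq_zero _ fun c h1 h2 => h2 (hcon c h1))
    have h2 : ∃ c, ((g : Cell →₀ M) - W') c ≠ 0 ∧ (x : Cell →₀ M) c ≠ 0 := by
      by_contra! hcon
      have h3 := form_eq_zero C.local_form (u := (g : Cell →₀ M) - W') (v := x)
        fun c h1 h2 => h2 (hcon c h1)
      rw [map_sub, AddMonoidHom.sub_apply, (C.mem_stab_iff _).1 hgs x x.2, zero_sub,
        neg_eq_zero] at h3
      exact hxne h3
    obtain ⟨c, hc, hxc⟩ := h1
    obtain ⟨c', hc', hxc'⟩ := h2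
    have h3 : -(ℓ : ℤ) ≤ c.1 := by
      by_contra hp
      exact hc (hneg _ hp)
    have h4 : ¬ -(ℓ : ℤ) ≤ c'.1 := fun hp => hc' (by
      rw [Finsupp.sub_apply, hpos _ hp, sub_self])
    have h5 : (g : Cell →₀ M) c' ≠ 0 := by
      rwa [Finsupp.sub_apply, hneg _ h4, sub_zero] at hc'
    have h6 := hgsupp c' h5
    have h7 := hx.dist_le hxc hxc'
    rw [mem_box] at h7
    by_cases hup : 0 ≤ c'.2
    · refine Or.inl fun s hs => ?_
      have h8 := hx.dist_le hxc hs
      have h9 := hx.dist_le hxc' hs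
      rw [mem_box] at h8 h9 ⊢
      simp only [Prod.smul_fst, Prod.smul_snd, smul_eq_mul]
      omega
    · refine Or.inr fun s hs => ?_
      have h8 := hx.dist_le hxc hs
      have h9 := hx.dist_le hxc' hs
      rw [mem_box] at h8 h9 ⊢
      simp only [Prod.smul_fst, Prod.smul_snd, smul_eq_mul]
      omega
  obtain ⟨Γ₁, Γ₂, h₁, h₂, h₁₂⟩ := hK (C.twist W') _ _ hviol (by
    intro c hc c' hc'
    rw [mem_box] at *
    simp only [Prod.smul_snd, smul_eq_mul] at *
    omega)
  refine ⟨r, by omega, Γ₁, h₁.mem_twists, W, W', hWs, ?_, by rwa [hform]⟩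
  refine ⟨?_, Γ₁, -Γ₂, Equivalent.refl _, h₁, ?_, h₂.neg, by rw [h₁₂, sub_neg_eq_add]⟩
  · intro c hc
    have h3 : -(ℓ : ℤ) ≤ c.1 := by
      by_contra hp
      exact hc (hneg _ hp)
    rw [hpos _ h3] at hc
    have h4 := hgsupp c hc
    rw [mem_strip]
    simp only [coord, one_mul, zero_mul, add_zero, zero_add]
    omega
  -- `W'` itself shows that the twist at the lower end, inverted, has the type of the one at the
  -- upper end.
  · exact Equivalent.symm ⟨W', by rw [h₁₂, sub_neg_eq_add]⟩

/-- Types which act on stabilizers unlike any Pauli operator braid nontrivially with some type. -/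
theorem exists_braiding_ne_zero [Finite C.Anyon] {Γ : C.GaugeHom} (hΓ : Γ ∈ C.twists)
    (h : ¬ ∃ P, ∀ g : C.gauge, (g : Cell →₀ M) ∈ C.stab → C.σ P g = Γ g) :
    ∃ Γ' ∈ C.twists, ∃ β ≠ (0 : Additive Circle), ∃ w₀ : ℕ, ∀ w ≥ w₀, ∃ L₀ : ℕ, ∀ L ≥ L₀,
      (∃ W, C.IsString Γ (1, 0) (0, 1) L w W) ∧ (∃ W', C.IsString Γ' (0, 1) (1, 0) L w W') ∧
      ∀ W W', C.IsString Γ (1, 0) (0, 1) L w W → C.IsString Γ' (0, 1) (1, 0) L w W' →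
        C.σ W' W = β := by
  obtain ⟨w₁, hw₁⟩ := exists_strings_form_ne_zero hΓ h
  have key : ∀ b : C.Anyon, ∃ (Γ' : C.twists) (β : Additive Circle) (w₀ : ℕ),
      (QuotientAddGroup.mk Γ' : C.Anyon) = b ∧ ∀ w ≥ w₀, ∃ L₀ : ℕ, ∀ L ≥ L₀,
      (∃ W, C.IsString Γ (1, 0) (0, 1) L w W) ∧
      (∃ W', C.IsString (Γ' : C.GaugeHom) (0, 1) (1, 0) L w W') ∧
      ∀ W W', C.IsString Γ (1, 0) (0, 1) L w W →
        C.IsString (Γ' : C.GaugeHom) (0, 1) (1, 0) L w W' → C.σ W' W = β := by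
    intro b
    obtain ⟨Γ', rfl⟩ := QuotientAddGroup.mk_surjective b
    obtain ⟨β, w₀, hβ⟩ := exists_braiding hΓ Γ'.2 isAxes
    exact ⟨Γ', β, w₀, rfl, hβ⟩
  choose Γb β w₀ hΓb hβ using key
  -- The type found by `exists_strings_form_ne_zero` depends on `L`. Finiteness of the set of types
  -- gives a width and then a length bound valid for all braiding phases at once, before that type
  -- is known.
  obtain ⟨w₂, hw₂⟩ := (Set.finite_range w₀).bddAbove
  have hw₂' : ∀ b, max w₁ w₂ ≥ w₀ b := fun b => (hw₂ ⟨b, rfl⟩).trans (le_max_right _ _)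
  choose L₀ hL₀ using fun b => hβ b (max w₁ w₂) (hw₂' b)
  obtain ⟨L₁, hL₁⟩ := (Set.finite_range L₀).bddAbove
  obtain ⟨L, hL, Γ', hΓ', W, W', hW, hW', hne⟩ := hw₁ _ (le_max_left w₁ w₂) L₁
  set b : C.Anyon := QuotientAddGroup.mk ⟨Γ', hΓ'⟩ with hb
  have heq : C.Equivalent Γ' (Γb b : C.GaugeHom) :=
    (anyon_eq_iff (Γ := ⟨Γ', hΓ'⟩)).1 (hb.symm.trans (hΓb b).symm)
  have hW'' : C.IsString (Γb b : C.GaugeHom) (0, 1) (1, 0) L (max w₁ w₂) W' := by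
    obtain ⟨h1, Γh, Γt, h2, h3, h4, h5, h6⟩ := hW'
    exact ⟨h1, Γh, Γt, h2.trans heq, h3, h4.trans heq, h5, h6⟩
  refine ⟨Γb b, (Γb b).2, β b, ?_, w₀ b, hβ b⟩
  rw [← (hL₀ b L ((hL₁ ⟨b, rfl⟩).trans hL)).2.2 W W' hW hW'']
  exact hne

end LatticeCode
end TopSubsystem

/-! ### Pauli operators modulo phases form a lattice code. -/

namespace TopSubsystem

/-- The character `x ↦ exp (2 π i x / n)` with values in the additive circle group. -/
def zmodChar (n : ℕ) [NeZero n] : ZMod n →+ Additive Circle :=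
  (ZMod.toCircle (N := n)).toAddMonoidHom

theorem zmodChar_apply (n : ℕ) [NeZero n] (x : ZMod n) :
    zmodChar n x = Additive.ofMul (ZMod.toCircle x) := rfl

/-- A character of `ZMod n` is determined by its value at `1`, an `n`-th root of unity, and every
such root is a value of `zmodChar n`. -/
theorem exists_zmodChar_mul_eq (n : ℕ) [NeZero n] (χ : ZMod n →+ Additive Circle) :
    ∃ a, ∀ x, zmodChar n (a * x) = χ x := by
  have h1 : (χ 1).toMul ^ n = 1 := by
    have : n • χ 1 = 0 := by rw [← map_nsmul]; simp
    exact this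
  obtain ⟨a, ha⟩ := (bijective_rootsOfUnityAddChar n).2 (rootsOfUnity.mkOfPowEq (χ 1).toMul h1)
  have ha' : zmodChar n a = χ 1 := by
    rw [zmodChar_apply, ← ZMod.rootsOfUnityAddChar_val, ha]
    simp
  refine ⟨a, fun x => ?_⟩
  rw [← ZMod.natCast_zmod_val x, ← nsmul_one, mul_smul_comm, mul_one, map_nsmul, map_nsmul, ha']

variable {Q : Type} [Fintype Q]

/-- Exponent vectors of the Pauli operators of a cell. -/
abbrev CellExpo (d : Q → ℕ) : Type := (∀ q, ZMod (d q)) × (∀ q, ZMod (d q))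

variable {d : Q → ℕ} [∀ q, NeZero (d q)]

variable (d) in
/-- Commutation phases of the Pauli operators of a cell. -/
def cellForm : CellExpo d →+ CellExpo d →+ Additive Circle :=
  AddMonoidHom.mk' (fun m => AddMonoidHom.mk'
    (fun m' => ∑ q, (zmodChar (d q) (m.2 q * m'.1 q) - zmodChar (d q) (m'.2 q * m.1 q))) (by
      intro a b
      rw [← Finset.sum_add_distrib]
      refine Finset.sum_congr rfl fun q _ => ?_
      simp only [Prod.fst_add, Prod.snd_add, Pi.add_apply, mul_add, add_mul, map_add]
      abel)) (by
    intro a b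
    ext1 m'
    simp only [AddMonoidHom.mk'_apply, AddMonoidHom.add_apply]
    rw [← Finset.sum_add_distrib]
    refine Finset.sum_congr rfl fun q _ => ?_
    simp only [Prod.fst_add, Prod.snd_add, Pi.add_apply, mul_add, add_mul, map_add]
    abel)

theorem cellForm_apply (m m' : CellExpo d) : cellForm d m m' =
    ∑ q, (zmodChar (d q) (m.2 q * m'.1 q) - zmodChar (d q) (m'.2 q * m.1 q)) := rfl

theorem cellForm_antisymm (m m' : CellExpo d) : cellForm d m m' = - cellForm d m' m := by
  simp [cellForm_apply]

theorem exists_cellForm_eq (χ : CellExpo d →+ Additive Circle) :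
    ∃ m, ∀ x, cellForm d m x = χ x := by
  classical
  choose a ha using fun q => exists_zmodChar_mul_eq (d q)
    ((χ.comp (AddMonoidHom.inl _ _)).comp (AddMonoidHom.single (fun q => ZMod (d q)) q))
  choose b hb using fun q => exists_zmodChar_mul_eq (d q)
    ((χ.comp (AddMonoidHom.inr _ _)).comp (AddMonoidHom.single (fun q => ZMod (d q)) q))
  -- `Z`-exponents detect `X`-exponents and conversely; the sign compensates the minus in
  -- `cellForm`.
  refine ⟨(-b, a), fun x => ?_⟩
  have hx : χ x = ∑ q, χ (AddMonoidHom.inl _ _ (Pi.single q (x.1 q))) +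
      ∑ q, χ (AddMonoidHom.inr _ _ (Pi.single q (x.2 q))) := by
    rw [← map_sum χ, ← map_sum χ,
      ← map_sum (AddMonoidHom.inl (∀ q, ZMod (d q)) (∀ q, ZMod (d q))),
      ← map_sum (AddMonoidHom.inr (∀ q, ZMod (d q)) (∀ q, ZMod (d q))),
      Finset.univ_sum_single, Finset.univ_sum_single, ← map_add]
    simp
  rw [cellForm_apply, hx]
  rw [← Finset.sum_add_distrib]
  refine Finset.sum_congr rfl fun q _ => ?_
  have h1 := ha q (x.1 q)
  have h2 := hb q (x.2 q)
  simp only [AddMonoidHom.comp_apply, AddMonoidHom.single_apply] at h1 h2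
  rw [← h1, ← h2]
  simp [mul_comm]

namespace Pauli

/-- The exponents of a Pauli operator. -/
def vec (P : Pauli d) : Cell →₀ CellExpo d := Finsupp.zipWith Prod.mk rfl P.x P.z

theorem vec_apply (P : Pauli d) (c : Cell) : vec P c = (P.x c, P.z c) := rfl

theorem vec_mul (P P' : Pauli d) : vec (P * P') = vec P + vec P' := by
  ext c <;> simp [vec_apply, mul_def]

theorem vec_ofPhase (c : Circle) : vec (ofPhase (d := d) c) = 0 := by
  ext c <;> simp [vec_apply, ofPhase]

theorem vec_one : vec (1 : Pauli d) = 0 := by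
  ext c <;> simp [vec_apply, one_def]

theorem vec_inv (P : Pauli d) : vec P⁻¹ = - vec P := by
  ext c <;> simp [vec_apply, inv_def]

theorem vec_translate (t : Cell) (P : Pauli d) : vec (P.translate t) = shift t (vec P) := by
  ext c <;> simp [vec_apply, translate, sub_eq_add_neg]

theorem supp_eq (P : Pauli d) : P.supp = {c | vec P c ≠ 0} := by
  ext c
  simp only [supp, Set.mem_ofPred_eq, vec_apply, ne_eq, Prod.mk_eq_zero]
  tauto

theorem supp_subset_iff {P : Pauli d} {R : Set Cell} :
    P.supp ⊆ R ↔ vec P ∈ supportedIn _ R := by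
  rw [supp_eq]
  rfl

/-- The Pauli operator with given exponents and trivial phase. -/
def ofVec (v : Cell →₀ CellExpo d) : Pauli d :=
  ⟨1, v.mapRange Prod.fst rfl, v.mapRange Prod.snd rfl⟩

@[simp] theorem vec_ofVec (v : Cell →₀ CellExpo d) : vec (ofVec v) = v := by
  ext c <;> simp [vec_apply, ofVec]

theorem exists_eq_ofPhase_mul {P P' : Pauli d} (h : vec P = vec P') :
    ∃ c, P = ofPhase c * P' := by
  have hx : P.x = P'.x := by
    ext1 c
    exact congrArg Prod.fst (DFunLike.congr_fun h c)
  have hz : P.z = P'.z := by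
    ext1 c
    exact congrArg Prod.snd (DFunLike.congr_fun h c)
  refine ⟨P.phase * P'.phase⁻¹, ?_⟩
  ext1
  · simp [mul_def, ofPhase, pairing_zero_left]
  · simp [mul_def, ofPhase, hx]
  · simp [mul_def, ofPhase, hz]

theorem pairing_eq_prod (z x : Expo d) (T : Finset Cell) (hT : z.support ⊆ T) :
    pairing z x = ∏ c ∈ T, ∏ q, ZMod.toCircle (z c q * x c q) :=
  Finsupp.prod_of_support_subset _ hT _ (by simp)

theorem form_vec (P G : Pauli d) :
    form (cellForm d) (vec P) (vec G) = Additive.ofMul (commPhase P G) := by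
  classical
  set T := (vec P).support ∪ P.z.support ∪ G.z.support with hT
  rw [form_apply, Finsupp.sum_of_support_subset _ (s := T)
    (Finset.subset_union_left.trans Finset.subset_union_left) _ (by simp), commPhase_eq,
    pairing_eq_prod P.z G.x T (Finset.subset_union_right.trans Finset.subset_union_left),
    pairing_eq_prod G.z P.x T Finset.subset_union_right, ← div_eq_mul_inv, ofMul_div,
    ofMul_prod, ofMul_prod, ← Finset.sum_sub_distrib]
  refine Finset.sum_congr rfl fun c _ => ?_
  rw [cellForm_apply, Finset.sum_sub_distrib, ofMul_prod, ofMul_prod]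
  rfl

theorem mul_eq_ofPhase_mul (P G : Pauli d) : P * G = ofPhase (commPhase P G) * (G * P) := by
  rw [← commutator_eq_ofPhase]
  group

theorem ofPhase_injective : Function.Injective (ofPhase (d := d)) :=
  fun _ _ h => congrArg Pauli.phase h

theorem mul_eq_ofPhase_mul_iff (P G : Pauli d) (β : Circle) :
    P * G = ofPhase β * (G * P) ↔ commPhase P G = β := by
  rw [mul_eq_ofPhase_mul, mul_left_inj, ofPhase_injective.eq_iff]

theorem mul_comm_iff (P G : Pauli d) : P * G = G * P ↔ commPhase P G = 1 := by
  rw [← mul_eq_ofPhase_mul_iff, map_one, one_mul]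

end Pauli

open Pauli

/-- The exponents of the elements of a group of Pauli operators. -/
def vecSubgroup (H : Subgroup (Pauli d)) : AddSubgroup (Cell →₀ CellExpo d) where
  carrier := {v | ∃ P ∈ H, vec P = v}
  zero_mem' := ⟨1, one_mem _, vec_one⟩
  add_mem' := by
    rintro _ _ ⟨P, hP, rfl⟩ ⟨P', hP', rfl⟩
    exact ⟨P * P', mul_mem hP hP', vec_mul _ _⟩
  neg_mem' := by
    rintro _ ⟨P, hP, rfl⟩
    exact ⟨P⁻¹, inv_mem hP, vec_inv _⟩

theorem vecSubgroup_local {H : Subgroup (Pauli d)} {ℓ : ℕ}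
    (h : Subgroup.closure {g : Pauli d | g ∈ H ∧ HasLinearSize ℓ g.supp} = H) :
    AddSubgroup.closure {g | g ∈ vecSubgroup H ∧ IsSmall ℓ g} = vecSubgroup H := by
  refine le_antisymm ((AddSubgroup.closure_le _).2 fun x hx => hx.1) ?_
  rintro _ ⟨P, hP, rfl⟩
  rw [← h] at hP
  induction hP using Subgroup.closure_induction with
  | mem x hx =>
    refine AddSubgroup.subset_closure ⟨⟨x, hx.1, rfl⟩, ?_⟩
    rw [IsSmall, ← supp_eq]
    exact hx.2
  | one => rw [vec_one]; exact zero_mem _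
  | mul x y _ _ hx hy => rw [vec_mul]; exact add_mem hx hy
  | inv x _ hx => rw [vec_inv]; exact neg_mem hx

namespace TopologicalSubsystemCode

variable (C : TopologicalSubsystemCode d)

theorem mem_gauge_iff {P : Pauli d} : P ∈ C.gauge ↔ vec P ∈ vecSubgroup C.gauge := by
  refine ⟨fun h => ⟨P, h, rfl⟩, fun ⟨P', hP', h⟩ => ?_⟩
  obtain ⟨c, rfl⟩ := exists_eq_ofPhase_mul h.symm
  exact mul_mem (C.phases_le_gauge ⟨c, rfl⟩) hP'

theorem stab_le : C.stab ≤ C.gauge ⊓ Subgroup.centralizer (C.gauge : Set (Pauli d)) :=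
  C.center_gauge ▸ le_sup_left

theorem mem_vecSubgroup_stab_iff (s : Cell →₀ CellExpo d) :
    s ∈ vecSubgroup C.stab ↔ ∀ g ∈ vecSubgroup C.gauge, form (cellForm d) s g = 0 := by
  constructor
  · rintro ⟨P, hP, rfl⟩ _ ⟨G, hG, rfl⟩
    rw [form_vec]
    have := (Subgroup.mem_centralizer_iff.1 (C.stab_le hP).2 G hG).symm
    rw [(mul_comm_iff P G).1 this]
    rfl
  · intro h
    have h1 : ofVec s ∈ Subgroup.centralizer (C.gauge : Set (Pauli d)) := by
      refine Subgroup.mem_centralizer_iff.2 fun G hG => ((mul_comm_iff _ _).2 ?_).symm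
      have := h _ ⟨G, hG, rfl⟩
      rw [← vec_ofVec s, form_vec] at this
      exact this
    have h2 : ofVec s ∈ C.gauge := by
      -- What commutes with the gauge group commutes with the stabilizers, hence is a gauge
      -- operator, hence central. This is where the topological condition on the centralizer enters.
      rw [← C.centralizer_stab]
      exact Subgroup.centralizer_le (fun x hx => (C.stab_le hx).1) h1
    have h3 : ofVec s ∈ C.stab ⊔ phases d := C.center_gauge ▸ ⟨h2, h1⟩
    have : ∀ P ∈ C.stab ⊔ phases d, vec P ∈ vecSubgroup C.stab := by
      intro P hP
      rw [Subgroup.sup_eq_closure] at hP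
      induction hP using Subgroup.closure_induction with
      | mem x hx =>
        obtain hx | ⟨c, rfl⟩ := hx
        · exact ⟨x, hx, rfl⟩
        · rw [vec_ofPhase]; exact zero_mem _
      | one => rw [vec_one]; exact zero_mem _
      | mul x y _ _ hx hy => rw [vec_mul]; exact add_mem hx hy
      | inv x _ hx => rw [vec_inv]; exact neg_mem hx
    simpa using this _ h3

/-- The code up to phases. -/
def lattice : LatticeCode (CellExpo d) where
  local_form := cellForm d
  local_form_antisymm := cellForm_antisymm
  exists_local_form_eq := exists_cellForm_eq
  gauge := vecSubgroup C.gauge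
  stab := vecSubgroup C.stab
  sizeG := C.sizeG
  sizeS := C.sizeS
  shift_mem_gauge := by
    rintro t _ ⟨P, hP, rfl⟩
    exact ⟨P.translate t, C.translation_invariant t P hP, vec_translate t P⟩
  gauge_local := vecSubgroup_local C.gauge_local
  stab_local := vecSubgroup_local C.stab_local
  stab_le_gauge := by
    rintro _ ⟨P, hP, rfl⟩
    exact ⟨P, (C.stab_le hP).1, rfl⟩
  mem_stab_iff := C.mem_vecSubgroup_stab_iff

end TopologicalSubsystemCode
end TopSubsystem

/-! ### Dictionary for twists, types and strings, and the conclusion. -/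

namespace TopSubsystem
variable {Q : Type} [Fintype Q] {d : Q → ℕ} [∀ q, NeZero (d q)]
namespace TopologicalSubsystemCode

open Pauli

variable (C : TopologicalSubsystemCode d)

theorem vec_mem_gauge (P : C.gauge) : vec (P : Pauli d) ∈ C.lattice.gauge := ⟨P, P.2, rfl⟩

theorem ofVec_mem_gauge (v : C.lattice.gauge) :
    ofVec (v : Cell →₀ CellExpo d) ∈ C.gauge := by
  rw [mem_gauge_iff, vec_ofVec]
  exact v.2

/-- Triviality on phases lets gauge twists descend to exponent vectors. -/
theorem twist_eq_of_vec_eq (Γ : C.gaugeTwists) {P P' : C.gauge}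
    (h : vec (P : Pauli d) = vec (P' : Pauli d)) :
    (Γ : C.gauge →* Circle) P = (Γ : C.gauge →* Circle) P' := by
  obtain ⟨c, hc⟩ := exists_eq_ofPhase_mul h
  have hcg : ofPhase c ∈ C.gauge := C.phases_le_gauge ⟨c, rfl⟩
  have : P = ⟨ofPhase c, hcg⟩ * P' := Subtype.ext hc
  rw [this, map_mul, Γ.2.1 ⟨ofPhase c, hcg⟩ ⟨c, rfl⟩, one_mul]

/-- A gauge twist as a homomorphism on the gauge group up to phases. -/
def toLattice : Additive C.gaugeTwists →+ C.lattice.GaugeHom where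
  toFun Γ := AddMonoidHom.mk' (fun v => Additive.ofMul
      ((Γ.toMul : C.gauge →* Circle) ⟨ofVec v, C.ofVec_mem_gauge v⟩)) (by
    intro v v'
    rw [← ofMul_mul, ← map_mul]
    refine congrArg Additive.ofMul (C.twist_eq_of_vec_eq _ ?_)
    simp [vec_mul])
  map_zero' := rfl
  map_add' _ _ := rfl

theorem toLattice_apply (Γ : C.gaugeTwists) (P : C.gauge) :
    C.toLattice (Additive.ofMul Γ) ⟨vec (P : Pauli d), C.vec_mem_gauge P⟩ =
      Additive.ofMul ((Γ : C.gauge →* Circle) P) :=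
  congrArg Additive.ofMul (C.twist_eq_of_vec_eq Γ (vec_ofVec _))

theorem toLattice_apply_eq_zero_iff (Γ : C.gaugeTwists) (P : C.gauge) :
    C.toLattice (Additive.ofMul Γ) ⟨vec (P : Pauli d), C.vec_mem_gauge P⟩ = 0 ↔
      (Γ : C.gauge →* Circle) P = 1 := by
  rw [toLattice_apply, ofMul_eq_zero]

theorem toLattice_injective : Function.Injective C.toLattice := by
  rw [injective_iff_map_eq_zero]
  intro Γ hΓ
  refine congrArg Additive.ofMul (Subtype.ext (MonoidHom.ext fun P => ?_) : Γ.toMul = 1)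
  have hΓ' : C.toLattice (Additive.ofMul Γ.toMul) = 0 := hΓ
  exact (C.toLattice_apply_eq_zero_iff _ P).1 (by rw [hΓ']; rfl)

theorem localizedIn_toLattice (Γ : C.gaugeTwists) (R : Set Cell) :
    C.lattice.LocalizedIn (C.toLattice (Additive.ofMul Γ)) R ↔
      C.LocalizedIn (Γ : C.gauge →* Circle) R := by
  constructor
  · intro h g hg hne
    rw [supp_subset_iff]
    rw [supp_eq] at hg
    exact h ⟨_, C.vec_mem_gauge g⟩ hg fun h0 => hne ((C.toLattice_apply_eq_zero_iff Γ g).1 h0)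
  · rintro h ⟨_, P, hP, rfl⟩ hg hne
    have := h ⟨P, hP⟩ (by rw [supp_eq]; exact hg) fun h0 =>
      hne ((C.toLattice_apply_eq_zero_iff Γ ⟨P, hP⟩).2 h0)
    rwa [supp_subset_iff] at this

theorem toLattice_mem_twists (Γ : C.gaugeTwists) :
    C.toLattice (Additive.ofMul Γ) ∈ C.lattice.twists := by
  obtain ⟨r, hr⟩ := Γ.2.2
  exact ⟨r, (C.localizedIn_toLattice Γ _).2 hr⟩

theorem exists_toLattice_eq {Γ : C.lattice.GaugeHom} (hΓ : Γ ∈ C.lattice.twists) :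
    ∃ Γ' : C.gaugeTwists, C.toLattice (Additive.ofMul Γ') = Γ := by
  let φ : C.gauge →* Circle :=
    MonoidHom.mk' (fun P => (Γ ⟨vec (P : Pauli d), C.vec_mem_gauge P⟩).toMul) (by
      intro P P'
      rw [← toMul_add, ← map_add]
      exact congrArg (fun v => (Γ v).toMul) (Subtype.ext (vec_mul _ _)))
  have hφ : ∀ g : C.gauge, φ g = (Γ ⟨vec (g : Pauli d), C.vec_mem_gauge g⟩).toMul := fun _ => rfl
  obtain ⟨r, hr⟩ := hΓ
  refine ⟨⟨φ, ?_, r, ?_⟩, ?_⟩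
  · rintro ⟨g, hg⟩ ⟨c, rfl⟩
    rw [hφ]
    have : (⟨vec (ofPhase c), C.vec_mem_gauge ⟨ofPhase c, hg⟩⟩ : C.lattice.gauge) = 0 :=
      Subtype.ext (vec_ofPhase c)
    rw [this, map_zero, toMul_zero]
  · intro g hg hne
    rw [supp_subset_iff]
    rw [supp_eq] at hg
    exact hr ⟨_, C.vec_mem_gauge g⟩ hg fun h0 => hne (by rw [hφ, h0, toMul_zero])
  · ext1 v
    exact congrArg Γ (Subtype.ext (vec_ofVec _))

theorem toLattice_pauliTwist (P : Pauli d) :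
    C.toLattice (Additive.ofMul (C.pauliTwist P)) = C.lattice.twist (vec P) := by
  ext1 ⟨_, G, hG, rfl⟩
  exact (C.toLattice_apply (C.pauliTwist P) ⟨G, hG⟩).trans (form_vec P G).symm

theorem toLattice_mul (Γ Γ' : C.gaugeTwists) : C.toLattice (Additive.ofMul (Γ * Γ')) =
    C.toLattice (Additive.ofMul Γ) + C.toLattice (Additive.ofMul Γ') :=
  map_add C.toLattice (Additive.ofMul Γ) (Additive.ofMul Γ')

theorem toLattice_inv (Γ : C.gaugeTwists) :
    C.toLattice (Additive.ofMul Γ⁻¹) = - C.toLattice (Additive.ofMul Γ) :=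
  map_neg C.toLattice (Additive.ofMul Γ)

theorem pauliTwist_eq_iff (W : Pauli d) (Γ : C.gaugeTwists) :
    C.pauliTwist W = Γ ↔ C.lattice.twist (vec W) = C.toLattice (Additive.ofMul Γ) := by
  rw [← toLattice_pauliTwist, C.toLattice_injective.eq_iff, Additive.ofMul.injective.eq_iff]

theorem anyonType_eq_iff (Γ Γ' : C.gaugeTwists) : C.anyonType Γ = C.anyonType Γ' ↔
    C.lattice.Equivalent (C.toLattice (Additive.ofMul Γ)) (C.toLattice (Additive.ofMul Γ')) := by
  rw [anyonType, anyonType, eq_comm, QuotientGroup.eq]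
  constructor
  · rintro ⟨P, hP⟩
    refine ⟨vec P, ?_⟩
    rw [(C.pauliTwist_eq_iff _ _).1 hP, toLattice_mul, toLattice_inv, neg_add_eq_sub]
  · rintro ⟨v, hv⟩
    refine ⟨ofVec v, ?_⟩
    rw [pauliTwist_eq_iff, vec_ofVec, hv, toLattice_mul, toLattice_inv, neg_add_eq_sub]

theorem finite_lattice_anyon [Finite C.AnyonType] : Finite C.lattice.Anyon := by
  choose F hF using fun Γ : C.lattice.twists => C.exists_toLattice_eq Γ.2
  refine Finite.of_injective (fun a : C.lattice.Anyon => C.anyonType (F a.out)) fun a b h => ?_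
  have := (C.anyonType_eq_iff _ _).1 h
  rw [hF, hF, ← LatticeCode.anyon_eq_iff] at this
  simpa using this

theorem isStringOperator_iff {e f : Cell} {γ : Set Cell} {L w : ℕ} (hγ : thicken γ w = strip e f L w)
    (Γ : C.gaugeTwists) (W : Pauli d) :
    C.IsStringOperator (C.anyonType Γ) γ ((-L : ℤ) • e) ((L : ℤ) • e) w W ↔
      C.lattice.IsString (C.toLattice (Additive.ofMul Γ)) e f L w (vec W) := by
  rw [IsStringOperator, LatticeCode.IsString, supp_subset_iff, hγ]
  refine and_congr_right fun _ => ?_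
  constructor
  · rintro ⟨Γh, Γt, h1, h2, h3, h4, h5⟩
    refine ⟨_, _, (C.anyonType_eq_iff Γh Γ).1 h1, (C.localizedIn_toLattice _ _).2 h2,
      (C.anyonType_eq_iff Γt Γ).1 h3, (C.localizedIn_toLattice _ _).2 h4, ?_⟩
    rw [(C.pauliTwist_eq_iff _ _).1 h5, toLattice_mul, toLattice_inv, sub_eq_add_neg]
  · rintro ⟨Γh, Γt, h1, h2, h3, h4, h5⟩
    obtain ⟨Γh, rfl⟩ := C.exists_toLattice_eq h2.mem_twists
    obtain ⟨Γt, rfl⟩ := C.exists_toLattice_eq h4.mem_twists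
    refine ⟨Γh, Γt, (C.anyonType_eq_iff _ _).2 h1, (C.localizedIn_toLattice _ _).1 h2,
      (C.anyonType_eq_iff _ _).2 h3, (C.localizedIn_toLattice _ _).1 h4, ?_⟩
    rw [pauliTwist_eq_iff, h5, toLattice_mul, toLattice_inv, sub_eq_add_neg]

theorem exists_near_of_abs_le {L w : ℕ} {k : ℤ} (h : -L - w ≤ k) (h' : k ≤ L + w) :
    ∃ u : ℤ, (-L ≤ u ∧ u ≤ L) ∧ u - w ≤ k ∧ k ≤ u + w := by
  by_cases h1 : k < -L
  · exact ⟨-L, by omega, by omega⟩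
  · by_cases h2 : (L : ℤ) < k
    · exact ⟨L, by omega, by omega⟩
    · exact ⟨k, by omega, by omega⟩

theorem thicken_horizontal (L w : ℕ) :
    thicken {s : Cell | |s.1| ≤ L ∧ s.2 = 0} w = strip (1, 0) (0, 1) L w := by
  ext s
  rw [mem_strip]
  simp only [thicken, Set.mem_ofPred_eq, mem_box, coord, one_mul, zero_mul, add_zero, zero_add,
    abs_le]
  constructor
  · rintro ⟨u, hu, hs⟩
    omega
  · intro hs
    obtain ⟨u, hu, hu'⟩ := exists_near_of_abs_le hs.1.1 hs.1.2
    exact ⟨(u, 0), ⟨hu, rfl⟩, hu', by simpa using hs.2⟩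

theorem thicken_vertical (L w : ℕ) :
    thicken {s : Cell | s.1 = 0 ∧ |s.2| ≤ L} w = strip (0, 1) (1, 0) L w := by
  ext s
  rw [mem_strip]
  simp only [thicken, Set.mem_ofPred_eq, mem_box, coord, one_mul, zero_mul, add_zero, zero_add,
    abs_le]
  constructor
  · rintro ⟨u, hu, hs⟩
    omega
  · intro hs
    obtain ⟨u, hu, hu'⟩ := exists_near_of_abs_le hs.1.1 hs.1.2
    exact ⟨(0, u), ⟨rfl, hu⟩, by simpa using hs.2, hu'⟩

theorem isHorizontalString_iff (Γ : C.gaugeTwists) (L w : ℕ) (W : Pauli d) :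
    C.IsHorizontalString (C.anyonType Γ) L w W ↔
      C.lattice.IsString (C.toLattice (Additive.ofMul Γ)) (1, 0) (0, 1) L w (vec W) := by
  rw [← C.isStringOperator_iff (thicken_horizontal L w), IsHorizontalString]
  simp

theorem isVerticalString_iff (Γ : C.gaugeTwists) (L w : ℕ) (W : Pauli d) :
    C.IsVerticalString (C.anyonType Γ) L w W ↔
      C.lattice.IsString (C.toLattice (Additive.ofMul Γ)) (0, 1) (1, 0) L w (vec W) := by
  rw [← C.isStringOperator_iff (thicken_vertical L w), IsVerticalString]
  simp

theorem isOpaque_of_isDetectable [Finite C.AnyonType] {a : C.AnyonType} (ha : C.IsDetectable a) :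
    C.IsOpaque a := by
  obtain ⟨Γ, rfl⟩ : ∃ Γ, C.anyonType Γ = a := QuotientGroup.mk_surjective a
  have := C.finite_lattice_anyon
  have h : ¬ ∃ P, ∀ g : C.lattice.gauge, (g : Cell →₀ CellExpo d) ∈ C.lattice.stab →
      C.lattice.σ P g = C.toLattice (Additive.ofMul Γ) g := by
    -- Correcting `Γ` by such a Pauli operator would give a twist of the same type violating no
    -- stabilizer, against detectability.
    rintro ⟨P, hP⟩
    obtain ⟨g, hg, hne⟩ := ha (Γ * (C.pauliTwist (ofVec P))⁻¹) (by
      rw [anyonType_eq_iff, toLattice_mul, toLattice_inv, toLattice_pauliTwist, vec_ofVec]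
      exact ⟨-P, by rw [map_neg]; abel⟩)
    refine hne ?_
    rw [← toLattice_apply_eq_zero_iff, toLattice_mul, toLattice_inv, toLattice_pauliTwist,
      vec_ofVec, AddMonoidHom.add_apply, AddMonoidHom.neg_apply, LatticeCode.twist_apply,
      hP _ ⟨g, hg, rfl⟩, add_neg_cancel]
  obtain ⟨Γ', hΓ', β, hβ, w₀, H⟩ :=
    LatticeCode.exists_braiding_ne_zero (C.toLattice_mem_twists Γ) h
  obtain ⟨Γ', rfl⟩ := C.exists_toLattice_eq hΓ'
  refine ⟨C.anyonType Γ', β.toMul, ⟨w₀, fun w hw => ?_⟩, hβ⟩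
  obtain ⟨L₀, hL₀⟩ := H w hw
  refine ⟨L₀, fun L hL => ?_⟩
  obtain ⟨⟨W, hW⟩, ⟨W', hW'⟩, huniq⟩ := hL₀ L hL
  refine ⟨⟨ofVec W, ?_⟩, ⟨ofVec W', ?_⟩, fun V V' hV hV' => ?_⟩
  · rwa [isHorizontalString_iff, vec_ofVec]
  · rwa [isVerticalString_iff, vec_ofVec]
  · rw [mul_eq_ofPhase_mul_iff]
    have := huniq _ _ ((C.isHorizontalString_iff _ _ _ _).1 hV)
      ((C.isVerticalString_iff _ _ _ _).1 hV')
    rw [← this]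
    exact (congrArg Additive.toMul (form_vec V' V)).symm

/-- The gauge group is generated by stabilizers and phases, so a twist violating no stabilizer is
identically `1` and represents the trivial type. -/
theorem isDetectable_of_ne_one (hC : C.IsStabilizerCode) {a : C.AnyonType} (ha : a ≠ 1) :
    C.IsDetectable a := by
  rintro Γ rfl
  by_contra! hcon
  refine ha ?_
  have hle : C.gauge ≤ (Γ : C.gauge →* Circle).ker.map C.gauge.subtype := by
    nth_rewrite 1 [hC]
    refine sup_le (fun x hx => ?_) fun x hx => ?_
    · exact ⟨⟨x, (C.stab_le hx).1⟩, hcon _ hx, rfl⟩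
    · exact ⟨⟨x, C.phases_le_gauge hx⟩, Γ.2.1 _ hx, rfl⟩
  have : Γ = 1 := by
    refine Subtype.ext (MonoidHom.ext fun g => ?_)
    obtain ⟨g', h1, h2⟩ := hle g.2
    rw [← Subtype.ext (a1 := g') (a2 := g) h2]
    exact h1
  rw [this]
  rfl

end TopologicalSubsystemCode
end TopSubsystem

end

theorem mainTheorem3 {Q : Type} [Fintype Q] (d : Q → ℕ) [∀ q, NeZero (d q)]
    (C : TopSubsystem.TopologicalSubsystemCode d) (hfin : Finite C.AnyonType) :
    (∀ a : C.AnyonType, C.IsDetectable a → C.IsOpaque a) ∧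
      (C.IsStabilizerCode → C.IsModular) :=
  ⟨fun _ ha => C.isOpaque_of_isDetectable ha,
    fun hC _ ha => C.isOpaque_of_isDetectable (C.isDetectable_of_ne_one hC ha)⟩
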